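/- Let $V$ be a finite-dimensional complex vector space, $n=\dim V$, let $G\subset GL(V)$ be a finite group and $\sigma:V\to Z=V/G$ the quotient projection. Equip $Z$ with the quotient topology and the sheaf of $G$-invariant holomorphic functions. For $K\le G$ let $Z_{(K)}\subset Z$ be the image of the set of points of $V$ whose isotropy group is conjugate to $K$ (the isotropy type strata), and let $Z_i$ be the complement of the union of all strata of codimension greater than $i$. Then $Z_0$ (the principal stratum) and $Z_1$ are complex manifolds. For $z\in Z_1\setminus Z_0$, local holomorphic coordinates $y^1,\dots,y^n$ of $Z_1$ centered at $z$ are called *adapted* if $Z_1\setminus Z_0=\{y^n=0\}$ near $z$. "Holomorphic linear connection" means a holomorphic complex linear connection, possibly with torsion. Let $U\subset V$ be a $G$-invariant open subset (for example $U=V$), and let $\gamma$ be a holomorphic linear connection on $Z_0\cap\sigma(U)$. Assume that for each $z\in (Z_1\setminus Z_0)\cap\sigma(U)$ there are adapted coordinates $y^1,\dots,y^n$ centered at $z$ and functions $\tilde\Gamma^a_{bc}$ holomorphic in a neighborhood of $z$ such that on the part of this neighborhood lying in $Z_0\cap\sigma(U)$ the components of $\gamma$ are, for $i,j,k\in\{1,\dots,n-1\}$,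 $$\gamma^i_{jk}=\tilde\Gamma^i_{jk},\quad \gamma^n_{jk}=y^n\tilde\Gamma^n_{jk},\quad \gamma^i_{jn}=\tilde\Gamma^i_{jn},\quad \gamma^i_{nk}=\tilde\Gamma^i_{nk},$$ $$\gamma^n_{jn}=\tilde\Gamma^n_{jn},\quad \gamma^n_{nk}=\tilde\Gamma^n_{nk},\quad \gamma^i_{nn}=\frac1{y^n}\tilde\Gamma^i_{nn},\quad \gamma^n_{nn}=\tilde\Gamma^n_{nn}-\frac{r-1}{r\,y^n},$$ where $r$ is the order of the isotropy group $G_v$ of any $v\in\sigma^{-1}(z)$. Then there is a unique $G$-invariant holomorphic linear connection $\Gamma$ on $U$ such that $\sigma_*\Gamma=\gamma$ on $Z_0\cap\sigma(U)$. -/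

import Mathlib

open Set Filter Topology

noncomputable section

namespace OrbitConnection

section Connections

variable {E F : Type*} [NormedAddCommGroup E] [NormedSpace ℂ E]
  [NormedAddCommGroup F] [NormedSpace ℂ F]

/-- The components `Γ^i_{jk}` of a complex linear connection at a point of (an open subset of)
a complex vector space `E`, as a bilinear map: `Γ X Y` has components `Γ^i_{jk} X^j Y^k`. The
connection is `∇_X Y = DY(X) + Γ X Y`. No symmetry is required, so torsion is allowed. -/
abbrev Components (E : Type*) [NormedAddCommGroup E] [NormedSpace ℂ E] : Type _ :=
  E →L[ℂ] E →L[ℂ] E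

/-- The transformation formula of linear connections. The locally biholomorphic map `y = f(x)`
carries the connection with components `Γ` to the one with components `γ`, at the point `x`:
`γ^a_{bc}(f(x)) ∂_j y^b ∂_k y^c = Γ^i_{jk}(x) ∂_i y^a - ∂_j ∂_k y^a`. -/
def TransformsAt (f : E → F) (Γ : E → Components E) (γ : F → Components F) (x : E) : Prop :=
  ∀ X Y : E, γ (f x) (fderiv ℂ f x X) (fderiv ℂ f x Y) =
    fderiv ℂ f x (Γ x X Y) - fderiv ℂ (fderiv ℂ f) x X Y

end Connections

variable {V : Type*} [NormedAddCommGroup V] [NormedSpace ℂ V]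

section OrbitSpace

variable (G : Subgroup (LinearMap.GeneralLinearGroup ℂ V))

/-- The orbit space `Z = V/G`, with the quotient topology. -/
abbrev OrbitSpace : Type _ := MulAction.orbitRel.Quotient G V

/-- The quotient projection `V → V/G`. -/
def proj (v : V) : OrbitSpace G := Quotient.mk _ v

/-- The sections of the structure sheaf of `V/G` over an open set `W`: the functions on `W` whose
pullback to `V` (which is automatically `G`-invariant) is holomorphic. -/
def IsHolomorphicOn (W : Set (OrbitSpace G)) (f : OrbitSpace G → ℂ) : Prop :=
  DifferentiableOn ℂ (fun v => f (proj G v)) (proj G ⁻¹' W)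

/-- The subspace of vectors fixed by a subgroup `K` of `G`. -/
def fixedSubspace (K : Subgroup G) : Submodule ℂ V where
  carrier := {v | ∀ g ∈ K, g • v = v}
  add_mem' {v w} hv hw g hg := by
    rw [smul_add, hv g hg, hw g hg]
  zero_mem' g _ := smul_zero g
  smul_mem' c v hv g hg := by
    have h : g • (c • v) = c • (g • v) :=
      ((g : LinearMap.GeneralLinearGroup ℂ V) : V →ₗ[ℂ] V).map_smul c v
    rw [h, hv g hg]

/-- The isotropy type stratum `Z_(K)`: the image of the set of points of `V` whose isotropy group
is conjugate to `K`. -/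
def stratum (K : Subgroup G) : Set (OrbitSpace G) :=
  proj G '' {v | ∃ g : G, MulAction.stabilizer G v = K.map (MulAut.conj g).toMonoidHom}

/-- The codimension of the stratum `Z_(K)` when it is nonempty: the points of `V` with isotropy
group `K` are then a nonempty open subset of the fixed subspace of `K`, and `V → V/G` is finite. -/
def stratumCodim (K : Subgroup G) : ℕ :=
  Module.finrank ℂ V - Module.finrank ℂ (fixedSubspace G K)

/-- `Z_i`: the complement of the union of all strata of codimension greater than `i`. -/
def strataUpTo (i : ℕ) : Set (OrbitSpace G) :=
  {z | ∃ K : Subgroup G, i < stratumCodim G K ∧ z ∈ stratum G K}ᶜ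

end OrbitSpace

/-- The coordinate space `ℂ^n`, where `n = dim V`. -/
abbrev Coord (V : Type*) [NormedAddCommGroup V] [NormedSpace ℂ V] : Type :=
  Fin (Module.finrank ℂ V) → ℂ

/-- A system of local holomorphic coordinates `y^1, …, y^n` on an open subset of `V/G`: a
homeomorphism onto an open subset of `ℂ^n` which identifies the structure sheaf of `V/G` with the
sheaf of holomorphic functions, i.e. an isomorphism of ringed spaces. -/
structure HolomorphicChart (G : Subgroup (LinearMap.GeneralLinearGroup ℂ V)) extends
    OpenPartialHomeomorph (OrbitSpace G) (Coord V) where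
  holomorphic_iff : ∀ O : Set (Coord V), IsOpen O → O ⊆ target → ∀ h : Coord V → ℂ,
    (DifferentiableOn ℂ h O ↔
      IsHolomorphicOn G (source ∩ toFun ⁻¹' O) (fun z => h (toFun z)))

/-- A holomorphic linear connection on an open subset `W` of `V/G` that is a complex manifold:
holomorphic components in every system of local holomorphic coordinates, related by the
transformation formula where two systems overlap. The components in the coordinates `φ` are
meaningful on the part of `W` that lies in the domain of `φ`. -/
structure HolomorphicConnection (G : Subgroup (LinearMap.GeneralLinearGroup ℂ V))
    (W : Set (OrbitSpace G)) where
  comp : HolomorphicChart G → Coord V → Components (Coord V)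
  holomorphic : ∀ φ : HolomorphicChart G,
    DifferentiableOn ℂ (comp φ) (φ.target ∩ φ.symm ⁻¹' W)
  transforms : ∀ φ ψ : HolomorphicChart G, ∀ z ∈ φ.source ∩ ψ.source ∩ W,
    TransformsAt (fun y => ψ.toFun (φ.symm y)) (comp φ) (comp ψ) (φ.toFun z)

section Adapted

variable {G : Subgroup (LinearMap.GeneralLinearGroup ℂ V)}

/-- Coordinates on an open subset of `Z_1`, centered at a point `z` of `Z_1 \ Z_0` and adapted to
the stratification: near `z` the hypersurface `Z_1 \ Z_0` is `{y^N = 0}`. The distinguished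
coordinate may carry any index `N`; writing it last is only a matter of numbering. -/
structure IsAdaptedAt (φ : HolomorphicChart G) (N : Fin (Module.finrank ℂ V))
    (z : OrbitSpace G) : Prop where
  source_subset : φ.source ⊆ strataUpTo G 1
  mem_source : z ∈ φ.source
  centered : φ.toFun z = 0
  adapted : ∀ᶠ x in 𝓝 z, (x ∈ strataUpTo G 1 \ strataUpTo G 0 ↔ φ.toFun x N = 0)

/-- The right-hand sides of the formulas for the components of a connection near `Z_1 \ Z_0`, in
terms of the coefficients `T^a_{bc}` and the value `yN` of the distinguished coordinate; `r` is
the order of the isotropy groups. With `i, j, k ≠ N` they are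
`γ^i_{jk} = T^i_{jk}`, `γ^N_{jk} = yN T^N_{jk}`, `γ^i_{jN} = T^i_{jN}`, `γ^i_{Nk} = T^i_{Nk}`,
`γ^N_{jN} = T^N_{jN}`, `γ^N_{Nk} = T^N_{Nk}`, `γ^i_{NN} = T^i_{NN} / yN`,
`γ^N_{NN} = T^N_{NN} - (r - 1) / (r yN)`. -/
def singularForm {n : ℕ} (r : ℕ) (N : Fin n) (T : Fin n → Fin n → Fin n → ℂ) (yN : ℂ)
    (a b c : Fin n) : ℂ :=
  if b = N ∧ c = N then
    if a = N then T a b c - ((r : ℂ) - 1) / ((r : ℂ) * yN) else T a b c / yN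
  else if a = N ∧ b ≠ N ∧ c ≠ N then yN * T a b c
  else T a b c

/-- Near `z` the connection `γ`, given on the open subset `W` of `Z_0`, has in the coordinates `φ`
components of the above form, with coefficients `T^a_{bc}` that are holomorphic in a whole
neighborhood `O` of the point (the poles and zeros along `y^N = 0` being the explicit ones). -/
def HasSingularFormAt {W : Set (OrbitSpace G)} (γ : HolomorphicConnection G W) (r : ℕ)
    (φ : HolomorphicChart G) (N : Fin (Module.finrank ℂ V)) (z : OrbitSpace G) : Prop :=
  ∃ (O : Set (Coord V)) (T : (a b c : Fin (Module.finrank ℂ V)) → Coord V → ℂ),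
    IsOpen O ∧ φ.toFun z ∈ O ∧ O ⊆ φ.target ∧
    (∀ a b c, DifferentiableOn ℂ (T a b c) O) ∧
    ∀ y ∈ O, φ.symm y ∈ W → ∀ a b c,
      γ.comp φ y (Pi.single b 1) (Pi.single c 1) a =
        singularForm r N (fun a b c => T a b c y) (y N) a b c

end Adapted

section Lift

variable (G : Subgroup (LinearMap.GeneralLinearGroup ℂ V))

/-- A connection on the `G`-invariant open set `U ⊆ V` is `G`-invariant: every `g ∈ G` carries it
to itself. -/
def IsInvariantOn (U : Set V) (Γ : V → Components V) : Prop :=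
  ∀ g : G, ∀ v ∈ U, TransformsAt (fun x : V => g • x) Γ Γ v

/-- The image of the connection `Γ` on `U` under the locally biholomorphic projection
`U ∩ V_reg → Z_0` is `γ`, expressed in all local holomorphic coordinates. -/
def PushforwardEq (U : Set V) (Γ : V → Components V)
    (γ : HolomorphicConnection G (strataUpTo G 0 ∩ proj G '' U)) : Prop :=
  ∀ φ : HolomorphicChart G, ∀ v ∈ U, proj G v ∈ φ.source ∩ strataUpTo G 0 →
    TransformsAt (fun x => φ.toFun (proj G x)) Γ (γ.comp φ) v

/-- `Γ` is a `G`-invariant holomorphic linear connection on `U` whose image under the projection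
is `γ` on the part of `Z_0` below `U`. -/
structure IsInvariantLift (U : Set V) (Γ : V → Components V)
    (γ : HolomorphicConnection G (strataUpTo G 0 ∩ proj G '' U)) : Prop where
  holomorphic : DifferentiableOn ℂ Γ U
  invariant : IsInvariantOn G U Γ
  pushforward : PushforwardEq G U Γ γ

end Lift

end OrbitConnection

end

/-!
Over the regular points the projection `σ : V → V/G` is a local isomorphism of ringed spaces, so
`γ` has a unique lift there: its pullback in any local coordinates
(`exists_chart_of_regular`, `exists_regular_lift`). The regular points are dense in `V`, which gives
uniqueness of `Γ`, and also its invariance, since a translate of a lift is a lift of the same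
connection (`isInvariantOn_of_pushforwardEq`). What remains is to extend the lift holomorphically
to all of `U`.

Let `v` lie over `Z_1 \ Z_0`. Its isotropy group is cyclic of order `r` and fixes a hyperplane
`l = 0` pointwise (`exists_reflectionData`). In adapted coordinates `φ` the distinguished component
of `φ ∘ σ` is `l ^ r` times a unit (`ReflectionData.exists_coordinate_eq`): it is divisible by
`l ^ r` because it is invariant and vanishes on the hyperplane; and `l ^ r`, being invariant, is a
holomorphic function of the coordinates which vanishes along `y^N = 0`, hence a multiple of `y^N`.
Extracting an `r`-th root of the unit yields coordinates `ξ` of `V` near `v` in which `φ ∘ σ` is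
the branched covering `ξ ↦ (ξ^1, …, (ξ^N)^r, …, ξ^n)`. The poles and zeros prescribed
for `γ` are exactly those that cancel in the pullback under this map: its coefficients are the
polynomial expressions `regularForm` in `ξ^N` and the `T^a_{bc}` (`transformsAt_branch`). So the
lift extends over the part of `U` above `Z_1` (`exists_local_extension_of_codim_one`).

The rest of `U` lies on finitely many subspaces of codimension at least two, and Hartogs' theorem
extends the lift across them (`exists_extension_of_codim_two`). The function theory of several
variables this needs (holomorphy of derivatives, division by the equation of a hyperplane, Hartogs'
theorem for subspaces) all follows from Cauchy's formula on circles in one direction, once integrals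
over translated circles are known to be holomorphic (`differentiableAt_circleIntegral`).
-/

noncomputable section

namespace OrbitConnection

/-! ### Holomorphic functions of several variables -/

section SeveralVariables

open Metric Real

variable {E F : Type*} [NormedAddCommGroup E] [NormedSpace ℂ E]
  [NormedAddCommGroup F] [NormedSpace ℂ F]

theorem eq_of_eqOn_dense {X Y : Type*} [TopologicalSpace X] [TopologicalSpace Y] [T2Space Y]
    {D : Set X} (hD : Dense D) {f g : X → Y} {x : X} (hf : ContinuousAt f x)
    (hg : ContinuousAt g x) (h : ∀ᶠ y in 𝓝 x, y ∈ D → f y = g y) : f x = g x := by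
  have := mem_closure_iff_nhdsWithin_neBot.1 (hD x)
  have hg' := hg.tendsto.mono_left (nhdsWithin_le_nhds (s := D))
  refine tendsto_nhds_unique (hf.tendsto.mono_left nhdsWithin_le_nhds) (hg'.congr' ?_)
  filter_upwards [nhdsWithin_le_nhds h, self_mem_nhdsWithin] with y hy hyD using (hy hyD).symm

theorem dense_compl_submodule {W : Submodule ℂ E} (hW : W ≠ ⊤) : Dense ((W : Set E)ᶜ) := by
  rw [← interior_eq_empty_iff_dense_compl]
  by_contra h
  exact hW (W.eq_top_of_nonempty_interior' (nonempty_iff_ne_empty.2 h))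

/-- A function given on an open dense set which extends holomorphically near every point extends
holomorphically. -/
theorem exists_differentiableOn_of_local {D U : Set E} (hD : Dense D) {f : E → F}
    (h : ∀ w ∈ U, ∃ (N : Set E) (g : E → F), IsOpen N ∧ w ∈ N ∧ DifferentiableOn ℂ g N ∧
      ∀ x ∈ N, x ∈ D → g x = f x) :
    ∃ g : E → F, DifferentiableOn ℂ g U ∧ ∀ x ∈ U, x ∈ D → g x = f x := by
  have key : ∀ (N : Set E) (g : E → F), IsOpen N → DifferentiableOn ℂ g N →
      (∀ x ∈ N, x ∈ D → g x = f x) → ∀ x ∈ N, extendFrom D f x = g x := by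
    intro N g hN hg hgf x hx
    refine extendFrom_eq (hD x) ?_
    have h1 : Tendsto g (𝓝[D] x) (𝓝 (g x)) :=
      (hg.continuousOn.continuousAt (hN.mem_nhds hx)).tendsto.mono_left nhdsWithin_le_nhds
    refine h1.congr' ?_
    filter_upwards [nhdsWithin_le_nhds (hN.mem_nhds hx), self_mem_nhdsWithin] with y hy hyD
      using hgf y hy hyD
  refine ⟨extendFrom D f, fun w hw => ?_, fun w hw hwD => ?_⟩
  · obtain ⟨N, g, hN, hwN, hg, hgf⟩ := h w hw
    refine (((hg w hwN).differentiableAt (hN.mem_nhds hwN)).congr_of_eventuallyEq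
      ?_).differentiableWithinAt
    filter_upwards [hN.mem_nhds hwN] with x hx using key N g hN hg hgf x hx
  · obtain ⟨N, g, hN, hwN, hg, hgf⟩ := h w hw
    rw [key N g hN hg hgf w hwN, hgf w hwN hwD]

/-- For a point `w` of an open set `S` and a direction `e` there is a radius such that the discs of
this radius in the direction `e`, centered at points near `w`, lie in `S`. -/
theorem exists_radius {S : Set E} (hS : IsOpen S) {w : E} (hw : w ∈ S) (e : E) :
    ∃ ρ > 0, ∃ N, IsOpen N ∧ w ∈ N ∧
      ∀ x ∈ N, ∀ z ∈ closedBall (0 : ℂ) ρ, x + z • e ∈ S := by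
  obtain ⟨δ, hδ, hδS⟩ := Metric.isOpen_iff.1 hS w hw
  have hu : 0 < ‖e‖ + 1 := by positivity
  refine ⟨δ / 2 / (‖e‖ + 1), by positivity, ball w (δ / 2), isOpen_ball,
    mem_ball_self (by positivity), fun x hx z hz => hδS ?_⟩
  rw [mem_ball, dist_eq_norm] at hx ⊢
  have h1 : ‖z • e‖ ≤ δ / 2 := by
    rw [norm_smul]
    have hz' : ‖z‖ ≤ δ / 2 / (‖e‖ + 1) := by simpa using hz
    calc ‖z‖ * ‖e‖ ≤ δ / 2 / (‖e‖ + 1) * (‖e‖ + 1) := by gcongr; linarith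
      _ = δ / 2 := by field_simp
  calc ‖x + z • e - w‖ = ‖(x - w) + z • e‖ := by congr 1; abel
    _ ≤ ‖x - w‖ + ‖z • e‖ := norm_add_le _ _
    _ < δ := by linarith

variable [FiniteDimensional ℂ E] [FiniteDimensional ℂ F]

/-- Integrals over a family of parallel translates of a circle depend holomorphically on the
translation. The derivatives under the integral sign are bounded by Cauchy's estimate. -/
theorem differentiableAt_circleIntegral {S : Set E} (hS : IsOpen S) {f : E → F}
    (hf : DifferentiableOn ℂ f S) {k : ℂ → ℂ} {ρ : ℝ} (hρ : 0 ≤ ρ)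
    (hk : ContinuousOn k (sphere 0 ρ)) {w e : E}
    (hw : ∀ z ∈ sphere (0 : ℂ) ρ, w + z • e ∈ S) :
    DifferentiableAt ℂ (fun x => ∮ z in C(0, ρ), k z • f (x + z • e)) w := by
  have : ProperSpace E := FiniteDimensional.proper ℂ E
  have : ProperSpace (E →L[ℂ] F) := FiniteDimensional.proper ℂ _
  have : CompleteSpace F := FiniteDimensional.complete ℂ F
  set p : ℝ → E := fun θ => circleMap 0 ρ θ • e with hp
  have hpc : Continuous p := (continuous_circleMap 0 ρ).smul continuous_const
  set c : ℝ → ℂ := fun θ => deriv (circleMap 0 ρ) θ * k (circleMap 0 ρ θ) with hc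
  have hcc : Continuous c := by
    have h1 : Continuous fun θ => k (circleMap 0 ρ θ) :=
      hk.comp_continuous (continuous_circleMap 0 ρ) fun θ => circleMap_mem_sphere _ hρ θ
    have h2 : Continuous fun θ => deriv (circleMap 0 ρ) θ := by
      simp only [deriv_circleMap]
      exact (continuous_circleMap 0 ρ).mul continuous_const
    exact h2.mul h1
  have heq : (fun x => ∮ z in C(0, ρ), k z • f (x + z • e)) =
      fun x => ∫ θ in (0 : ℝ)..2 * π, c θ • f (x + p θ) := by
    funext x
    simp only [circleIntegral, hc, hp, smul_smul]
  rw [heq]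
  set K : Set E := (fun z : ℂ => w + z • e) '' sphere 0 ρ with hK
  have hKc : IsCompact K := (isCompact_sphere 0 ρ).image (by fun_prop)
  have hKS : K ⊆ S := by rintro _ ⟨z, hz, rfl⟩; exact hw z hz
  obtain ⟨δ, hδ, hδS⟩ := hKc.exists_cthickening_subset_open hS hKS
  have hcomp : IsCompact (cthickening δ K) := hKc.cthickening
  obtain ⟨M, hM⟩ := hcomp.exists_bound_of_continuousOn (hf.continuousOn.mono hδS)
  have hmem : ∀ θ, ∀ x ∈ ball w (δ / 2), ball (x + p θ) (δ / 2) ⊆ cthickening δ K := by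
    intro θ x hx y hy
    refine mem_cthickening_of_dist_le y (w + p θ) δ K
      ⟨_, circleMap_mem_sphere 0 hρ θ, rfl⟩ ?_
    have h1 : dist y (x + p θ) < δ / 2 := hy
    have h2 : dist (x + p θ) (w + p θ) < δ / 2 := by simpa using hx
    linarith [dist_triangle y (x + p θ) (w + p θ)]
  have hmem' : ∀ θ, ∀ x ∈ ball w (δ / 2), x + p θ ∈ S := fun θ x hx =>
    hδS (hmem θ x hx (mem_ball_self (by positivity)))
  have hcont : ∀ x ∈ ball w (δ / 2), Continuous fun θ => c θ • f (x + p θ) := by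
    intro x hx
    refine hcc.smul (hf.continuousOn.comp_continuous (by fun_prop) fun θ => hmem' θ x hx)
  obtain ⟨C, hC⟩ := (isCompact_uIcc (a := (0 : ℝ)) (b := 2 * π)).exists_bound_of_continuousOn
    hcc.continuousOn
  have hder := intervalIntegral.hasFDerivAt_integral_of_dominated_of_fderiv_le
    (𝕜 := ℂ) (μ := MeasureTheory.volume) (a := 0) (b := 2 * π)
    (F := fun x θ => c θ • f (x + p θ)) (F' := fun x θ => c θ • fderiv ℂ f (x + p θ))
    (x₀ := w) (s := ball w (δ / 2)) (bound := fun _ => |C| * (2 * M / (δ / 2)))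
    (ball_mem_nhds w (by positivity))
    (by
      filter_upwards [ball_mem_nhds w (half_pos hδ)] with x hx
      exact (hcont x hx).aestronglyMeasurable)
    ((hcont w (mem_ball_self (by positivity))).intervalIntegrable _ _)
    (by
      borelize E
      refine hcc.aestronglyMeasurable.smul ?_
      have hwp : Continuous fun θ => w + p θ := by fun_prop
      exact ((measurable_fderiv ℂ f).comp hwp.measurable).aestronglyMeasurable)
    (by
      refine Eventually.of_forall fun θ hθ x hx => ?_
      rw [norm_smul]
      refine mul_le_mul ((hC θ (uIoc_subset_uIcc hθ)).trans (le_abs_self C)) ?_ (norm_nonneg _)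
        (abs_nonneg _)
      refine Complex.norm_fderiv_le_div_of_mapsTo_ball
        (hf.mono ((hmem θ x hx).trans hδS)) ?_ (by positivity)
      intro y hy
      rw [mem_closedBall, dist_eq_norm]
      have h1 := hM y (hmem θ x hx hy)
      have h2 := hM (x + p θ) (hmem θ x hx (mem_ball_self (by positivity)))
      linarith [norm_sub_le (f y) (f (x + p θ))])
    (by simp)
    (by
      refine Eventually.of_forall fun θ hθ x hx => ?_
      have h1 : HasFDerivAt f (fderiv ℂ f (x + p θ)) (x + p θ) :=
        ((hf _ (hmem' θ x hx)).differentiableAt (hS.mem_nhds (hmem' θ x hx))).hasFDerivAt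
      have h2 : HasFDerivAt (fun y => y + p θ) (ContinuousLinearMap.id ℂ E) x :=
        (hasFDerivAt_id x).add_const (p θ)
      exact (h1.comp x h2).const_smul (c θ))
  exact hder.differentiableAt

/-- A map into a space of continuous linear maps is differentiable if its evaluations are. -/
theorem differentiableAt_of_forall_apply {E' F' : Type*} [NormedAddCommGroup E'] [NormedSpace ℂ E']
    [NormedAddCommGroup F'] [NormedSpace ℂ F'] {A : E' → E →L[ℂ] F'} {x : E'}
    (h : ∀ u, DifferentiableAt ℂ (fun y => A y u) x) :
    DifferentiableAt ℂ A x := by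
  let b := Module.finBasis ℂ E
  have : A = fun y => ∑ i, (LinearMap.toContinuousLinearMap (b.coord i)).smulRight (A y (b i)) := by
    funext y
    ext u
    conv_lhs => rw [← b.sum_repr u]
    rw [map_sum]
    simp
  rw [this]
  refine DifferentiableAt.fun_sum fun i _ => ?_
  exact ((ContinuousLinearMap.smulRightL ℂ E F'
    (LinearMap.toContinuousLinearMap (b.coord i))).differentiableAt).comp x (h (b i))

/-- The derivative of a holomorphic map is holomorphic. -/
theorem differentiableOn_fderiv {S : Set E} (hS : IsOpen S) {f : E → F}
    (hf : DifferentiableOn ℂ f S) : DifferentiableOn ℂ (fderiv ℂ f) S := by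
  have : CompleteSpace F := FiniteDimensional.complete ℂ F
  intro w hw
  refine (differentiableAt_of_forall_apply fun u => ?_).differentiableWithinAt
  obtain ⟨ρ, hρ0, N, hN, hwN, hin⟩ := exists_radius hS hw u
  have hform : ∀ x ∈ N, fderiv ℂ f x u =
      (2 * π * Complex.I : ℂ)⁻¹ • ∮ z in C(0, ρ), ((z - 0) ^ 2)⁻¹ • f (x + z • u) := by
    intro x hx
    have hopen : IsOpen ((fun z : ℂ => x + z • u) ⁻¹' S) := hS.preimage (by fun_prop)
    have hd : DifferentiableOn ℂ (fun z : ℂ => f (x + z • u)) ((fun z : ℂ => x + z • u) ⁻¹' S) :=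
      hf.comp (by fun_prop) fun z hz => hz
    rw [Complex.two_pi_I_inv_smul_circleIntegral_sub_sq_inv_smul_of_differentiable hopen
      (hin x hx) hd (mem_ball_self hρ0)]
    have hx0 : x + (0 : ℂ) • u ∈ S := hin x hx 0 (mem_closedBall_self hρ0.le)
    have h1 : HasFDerivAt f (fderiv ℂ f x) (x + (0 : ℂ) • u) := by
      rw [zero_smul, add_zero] at hx0 ⊢
      exact ((hf _ hx0).differentiableAt (hS.mem_nhds hx0)).hasFDerivAt
    have h2 : HasDerivAt (fun z : ℂ => x + z • u) u 0 := by
      simpa using ((hasDerivAt_id (0 : ℂ)).smul_const u).const_add x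
    exact (h1.comp_hasDerivAt (0 : ℂ) h2).deriv.symm
  have hev : (fun x => fderiv ℂ f x u) =ᶠ[𝓝 w] fun x =>
      (2 * π * Complex.I : ℂ)⁻¹ • ∮ z in C(0, ρ), ((z - 0) ^ 2)⁻¹ • f (x + z • u) := by
    filter_upwards [hN.mem_nhds hwN] with x hx using hform x hx
  refine DifferentiableAt.congr_of_eventuallyEq ?_ hev
  refine (differentiableAt_circleIntegral hS hf hρ0.le ?_ fun z hz =>
    hin w hwN z (sphere_subset_closedBall hz)).const_smul _
  refine ContinuousOn.inv₀ (by fun_prop) fun z hz => ?_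
  have : z ≠ 0 := ne_of_mem_sphere hz hρ0.ne'
  simpa using this

/-- A holomorphic function vanishing on a hyperplane is locally divisible by its equation. The
quotient is holomorphic because Cauchy's formula expresses it through its values away from the
hyperplane. -/
theorem exists_eq_mul_of_eq_zero {S : Set E} (hS : IsOpen S) {a : E → ℂ}
    (ha : DifferentiableOn ℂ a S) (l : E →L[ℂ] ℂ) {e : E} (he : l e = 1)
    (h0 : ∀ x ∈ S, l x = 0 → a x = 0) {w : E} (hw : w ∈ S) (hlw : l w = 0) :
    ∃ (N : Set E) (b : E → ℂ), IsOpen N ∧ w ∈ N ∧ N ⊆ S ∧ DifferentiableOn ℂ b N ∧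
      ∀ x ∈ N, a x = l x * b x := by
  obtain ⟨ρ, hρ, N, hN, hwN, hNS⟩ := exists_radius hS hw e
  have hl : ∀ x z, l (x + z • e) = l x + z := by simp [he]
  have hne : ∀ x, ‖l x‖ < ρ → ∀ z ∈ sphere (0 : ℂ) ρ, l x + z ≠ 0 := by
    intro x hx z hz h
    have : ‖z‖ = ρ := by simpa using hz
    rw [eq_neg_of_add_eq_zero_left h, norm_neg] at hx
    linarith
  refine ⟨N ∩ {x | ‖l x‖ < ρ}, fun x => (2 * π * Complex.I : ℂ)⁻¹ •
    ∮ z in C(0, ρ), (z - 0)⁻¹ • (fun y => a y / l y) (x + z • e),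
    hN.inter (isOpen_lt (by fun_prop) continuous_const), ⟨hwN, by simpa [hlw] using hρ⟩,
    fun x hx => ?_, fun x hx => ?_, fun x hx => ?_⟩
  · simpa using hNS x hx.1 0 (mem_closedBall_self hρ.le)
  · refine DifferentiableAt.differentiableWithinAt (DifferentiableAt.fun_const_smul ?_ _)
    refine differentiableAt_circleIntegral (S := S ∩ {y | l y ≠ 0}) (f := fun y => a y / l y)
      (k := fun z => (z - 0)⁻¹)
      (hS.inter (isOpen_ne_fun (by fun_prop) continuous_const)) ?_ hρ.le ?_ ?_
    · simp only [div_eq_mul_inv]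
      exact (ha.mono inter_subset_left).fun_mul
        (l.differentiable.differentiableOn.fun_inv fun y hy => hy.2)
    · refine ContinuousOn.inv₀ (by fun_prop) fun z hz => ?_
      simpa using ne_of_mem_sphere hz hρ.ne'
    · intro z hz
      refine ⟨hNS x hx.1 z (sphere_subset_closedBall hz), ?_⟩
      rw [mem_ofPred_eq, hl]
      exact hne x hx.2 z hz
  · set T : Set ℂ := (fun z : ℂ => x + z • e) ⁻¹' S with hT
    have hTo : IsOpen T := hS.preimage (by fun_prop)
    have hTc : closedBall (0 : ℂ) ρ ⊆ T := fun z hz => hNS x hx.1 z hz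
    set g : ℂ → ℂ := fun z => a (x + z • e) with hg
    have hgd : DifferentiableOn ℂ g T := ha.comp (by fun_prop) fun z hz => hz
    have hz0 : -l x ∈ ball (0 : ℂ) ρ := by simpa using hx.2
    have hgz : g (-l x) = 0 := h0 _ (hTc (ball_subset_closedBall hz0)) (by rw [hl]; ring)
    have hD : DifferentiableOn ℂ (dslope g (-l x)) T :=
      (Complex.differentiableOn_dslope
        (hTo.mem_nhds (hTc (ball_subset_closedBall hz0)))).2 hgd
    have hval : ∀ z, g z = (l x + z) * dslope g (-l x) z := by
      intro z
      have := sub_smul_dslope g (-l x) z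
      rw [hgz, sub_zero, smul_eq_mul] at this
      rw [← this]
      ring
    have hint : ∮ z in C(0, ρ), (z - 0)⁻¹ • (fun y => a y / l y) (x + z • e) =
        ∮ z in C(0, ρ), (z - 0)⁻¹ • dslope g (-l x) z := by
      refine circleIntegral.integral_congr hρ.le fun z hz => ?_
      have h1 : a (x + z • e) = (l x + z) * dslope g (-l x) z := hval z
      simp only [hl, h1]
      rw [mul_div_cancel_left₀ _ (hne x hx.2 z hz)]
    beta_reduce
    rw [hint, (hD.diffContOnCl_ball hTc).two_pi_i_inv_smul_circleIntegral_sub_inv_smul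
      (mem_ball_self hρ)]
    have := hval 0
    simpa [hg] using this

/-- Hartogs' extension theorem across a linear subspace of codimension at least two, locally. The
extension is the mean over circles in a direction `e` transverse to the subspace `W`; it agrees
with the given function off the proper subspace `W ⊔ ℂ e`. -/
theorem exists_local_extension_of_codim_two {U : Set E} (hU : IsOpen U) {W : Submodule ℂ E}
    (hW : Module.finrank ℂ W + 2 ≤ Module.finrank ℂ E) {f : E → F}
    (hf : DifferentiableOn ℂ f (U \ W)) {w : E} (hw : w ∈ U) :
    ∃ (N : Set E) (g : E → F), IsOpen N ∧ w ∈ N ∧ DifferentiableOn ℂ g N ∧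
      ∀ x ∈ N, x ∈ (W : Set E)ᶜ → g x = f x := by
  have : CompleteSpace F := FiniteDimensional.complete ℂ F
  have hWc : IsClosed (W : Set E) := W.closed_of_finiteDimensional
  by_cases hwW : w ∈ W
  swap
  · exact ⟨U \ W, f, hU.sdiff hWc, ⟨hw, hwW⟩, hf, fun _ _ _ => rfl⟩
  have hWtop : W ≠ ⊤ := by
    rintro rfl
    rw [finrank_top] at hW
    omega
  obtain ⟨e, -, heW⟩ := SetLike.exists_of_lt (lt_top_iff_ne_top.2 hWtop)
  obtain ⟨l', hl'e, hl'W⟩ := Submodule.exists_le_ker_of_notMem heW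
  set l : E →L[ℂ] ℂ := LinearMap.toContinuousLinearMap ((l' e)⁻¹ • l') with hldef
  have he : l e = 1 := by simp [hldef, hl'e]
  have hlW : ∀ x ∈ W, l x = 0 := fun x hx => by
    have : l' x = 0 := hl'W hx
    simp [hldef, this]
  set W' : Submodule ℂ E := W ⊔ Submodule.span ℂ {e} with hW'
  have hW'top : W' ≠ ⊤ := by
    intro h
    have h1 : Module.finrank ℂ W' ≤
        Module.finrank ℂ W + Module.finrank ℂ (Submodule.span ℂ {e}) :=
      Submodule.finrank_add_le_finrank_add_finrank _ _
    have h2 : Module.finrank ℂ (Submodule.span ℂ {e}) ≤ 1 := by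
      simpa using finrank_span_le_card (R := ℂ) ({e} : Set E)
    rw [h, finrank_top] at h1
    omega
  obtain ⟨ρ, hρ, N, hN, hwN, hNU⟩ := exists_radius hU hw e
  have hl : ∀ x z, l (x + z • e) = l x + z := by simp [he]
  have hoff : ∀ x, ‖l x‖ < ρ → ∀ z ∈ sphere (0 : ℂ) ρ, x + z • e ∉ W := by
    intro x hx z hz h
    have h1 := hlW _ h
    have : ‖z‖ = ρ := by simpa using hz
    rw [hl] at h1
    rw [eq_neg_of_add_eq_zero_left h1, norm_neg] at hx
    linarith
  set N' : Set E := N ∩ {x | ‖l x‖ < ρ} with hN'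
  have hN'o : IsOpen N' := hN.inter (isOpen_lt (by fun_prop) continuous_const)
  set g : E → F := fun x => (2 * π * Complex.I : ℂ)⁻¹ •
    ∮ z in C(0, ρ), (z - 0)⁻¹ • f (x + z • e) with hg
  have hgd : DifferentiableOn ℂ g N' := by
    intro x hx
    refine DifferentiableAt.differentiableWithinAt (DifferentiableAt.const_smul ?_ _)
    refine differentiableAt_circleIntegral (k := fun z => (z - 0)⁻¹) (hU.sdiff hWc) hf hρ.le ?_
      fun z hz => ⟨hNU x hx.1 z (sphere_subset_closedBall hz), hoff x hx.2 z hz⟩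
    refine ContinuousOn.inv₀ (by fun_prop) fun z hz => ?_
    simpa using ne_of_mem_sphere hz hρ.ne'
  have hgf : ∀ x ∈ N', x ∈ (W' : Set E)ᶜ → g x = f x := by
    intro x hx hxW'
    set T : Set ℂ := (fun z : ℂ => x + z • e) ⁻¹' (U \ W) with hT
    have hTc : closedBall (0 : ℂ) ρ ⊆ T := by
      refine fun z hz => ⟨hNU x hx.1 z hz, fun hzW => hxW' ?_⟩
      have : x = (x + z • e) + (-z) • e := by rw [neg_smul]; abel
      rw [this]
      exact W'.add_mem (Submodule.mem_sup_left hzW) (Submodule.mem_sup_right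
        (Submodule.smul_mem _ _ (Submodule.mem_span_singleton_self e)))
    have hd : DifferentiableOn ℂ (fun z : ℂ => f (x + z • e)) T :=
      hf.comp (by fun_prop) fun z hz => hz
    simp only [hg]
    rw [(hd.diffContOnCl_ball hTc).two_pi_i_inv_smul_circleIntegral_sub_inv_smul
      (mem_ball_self hρ), zero_smul, add_zero]
  refine ⟨N', g, hN'o, ⟨hwN, by simpa [hlW w hwW] using hρ⟩, hgd, fun x hx hxW => ?_⟩
  have hxU : x ∈ U := by simpa using hNU x hx.1 0 (mem_closedBall_self hρ.le)
  refine eq_of_eqOn_dense (dense_compl_submodule hW'top)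
    (hgd.continuousOn.continuousAt (hN'o.mem_nhds hx))
    (hf.continuousOn.continuousAt ((hU.sdiff hWc).mem_nhds ⟨hxU, hxW⟩)) ?_
  filter_upwards [hN'o.mem_nhds hx] with y hy hyW using hgf y hy hyW

/-- Hartogs' extension theorem across finitely many subspaces of codimension at least two. -/
theorem exists_extension_of_codim_two (s : Finset (Submodule ℂ E)) {U : Set E} (hU : IsOpen U)
    (hs : ∀ W ∈ s, Module.finrank ℂ W + 2 ≤ Module.finrank ℂ E) {f : E → F}
    (hf : DifferentiableOn ℂ f {x | x ∈ U ∧ ∀ W ∈ s, x ∉ W}) :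
    ∃ g : E → F, DifferentiableOn ℂ g U ∧ ∀ x ∈ U, (∀ W ∈ s, x ∉ W) → g x = f x := by
  classical
  induction s using Finset.induction_on generalizing f with
  | empty => exact ⟨f, by simpa using hf, fun _ _ _ => rfl⟩
  | insert W s hWs ih =>
    have hW := hs W (Finset.mem_insert_self W s)
    have hs' : ∀ W ∈ s, Module.finrank ℂ W + 2 ≤ Module.finrank ℂ E := fun W' hW' =>
      hs W' (Finset.mem_insert_of_mem hW')
    have hopen : IsOpen {x | x ∈ U ∧ ∀ W ∈ s, x ∉ W} := by
      refine hU.inter ?_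
      have : {x : E | ∀ W ∈ s, x ∉ W} = ⋂ W ∈ s, ((W : Set E)ᶜ) := by
        ext x
        simp
      change IsOpen {x : E | ∀ W ∈ s, x ∉ W}
      rw [this]
      exact isOpen_biInter_finset fun W _ =>
        W.closed_of_finiteDimensional.isOpen_compl
    have hWtop : W ≠ ⊤ := by
      rintro rfl
      rw [finrank_top] at hW
      omega
    have hf' : DifferentiableOn ℂ f ({x | x ∈ U ∧ ∀ W ∈ s, x ∉ W} \ W) := by
      refine hf.mono fun x hx => ⟨hx.1.1, fun W' hW' => ?_⟩
      rcases Finset.mem_insert.1 hW' with rfl | h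
      · exact hx.2
      · exact hx.1.2 W' h
    obtain ⟨f₁, hf₁, hf₁f⟩ := exists_differentiableOn_of_local (dense_compl_submodule hWtop)
      fun w hw => exists_local_extension_of_codim_two hopen hW hf' hw
    obtain ⟨g, hg, hgf⟩ := ih hs' hf₁
    refine ⟨g, hg, fun x hx hxs => ?_⟩
    have h1 : ∀ W ∈ s, x ∉ W := fun W' hW' => hxs W' (Finset.mem_insert_of_mem hW')
    rw [hgf x hx h1, hf₁f x ⟨hx, h1⟩ (hxs W (Finset.mem_insert_self W s))]

end SeveralVariables

/-! ### The orbit space and its strata -/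

section Action

variable {V : Type*} [NormedAddCommGroup V] [NormedSpace ℂ V]
  (G : Subgroup (LinearMap.GeneralLinearGroup ℂ V))

/-- The linear automorphism by which an element of `G` acts. -/
def actionEquiv (g : G) : V ≃ₗ[ℂ] V :=
  LinearMap.GeneralLinearGroup.generalLinearEquiv ℂ V (g : LinearMap.GeneralLinearGroup ℂ V)

@[simp]
theorem actionEquiv_apply (g : G) (v : V) : actionEquiv G g v = g • v := rfl

variable {G} in
theorem eq_one_of_forall_smul {g : G} (h : ∀ v : V, g • v = v) : g = 1 :=
  Subtype.ext (Units.ext (LinearMap.ext h))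

@[simp]
theorem proj_smul (g : G) (v : V) : proj G (g • v) = proj G v :=
  Quotient.sound ⟨g, rfl⟩

theorem proj_eq_iff {v w : V} : proj G v = proj G w ↔ ∃ g : G, g • w = v :=
  Quotient.eq (r := MulAction.orbitRel G V)

theorem proj_surjective : Function.Surjective (proj G) := Quot.mk_surjective

theorem continuous_proj : Continuous (proj G) := continuous_quot_mk

theorem fixedSubspace_map_conj (K : Subgroup G) (g : G) :
    fixedSubspace G (K.map (MulAut.conj g).toMonoidHom) =
      (fixedSubspace G K).map (actionEquiv G g : V →ₗ[ℂ] V) := by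
  ext v
  rw [Submodule.mem_map_equiv]
  have hsymm : (actionEquiv G g).symm v = g⁻¹ • v := by
    rw [LinearEquiv.symm_apply_eq, actionEquiv_apply, smul_inv_smul]
  rw [hsymm]
  constructor
  · intro h k hk
    have := h (g * k * g⁻¹) ⟨k, hk, rfl⟩
    rw [mul_smul, mul_smul] at this
    rw [eq_inv_smul_iff, this]
  · rintro h _ ⟨k, hk, rfl⟩
    have := h k hk
    change (g * k * g⁻¹) • v = v
    rw [mul_smul, mul_smul, this, smul_inv_smul]

theorem stratumCodim_map_conj (K : Subgroup G) (g : G) :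
    stratumCodim G (K.map (MulAut.conj g).toMonoidHom) = stratumCodim G K := by
  rw [stratumCodim, stratumCodim, fixedSubspace_map_conj, LinearEquiv.finrank_map_eq]

/-- The stratum of a point can be read off from the fixed subspace of its own isotropy group. -/
theorem proj_mem_strataUpTo_iff {i : ℕ} {v : V} :
    proj G v ∈ strataUpTo G i ↔ stratumCodim G (MulAction.stabilizer G v) ≤ i := by
  constructor
  · intro h
    by_contra hi
    refine h ⟨MulAction.stabilizer G v, not_le.1 hi, v, ⟨1, ?_⟩, rfl⟩
    rw [map_one]
    exact (Subgroup.map_id _).symm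
  · rintro h ⟨K, hK, w, ⟨g, hg⟩, hw⟩
    obtain ⟨g', rfl⟩ := (proj_eq_iff G).1 hw
    rw [MulAction.stabilizer_smul_eq_stabilizer_map_conj] at hg
    have := congrArg (stratumCodim G) hg
    rw [stratumCodim_map_conj, stratumCodim_map_conj] at this
    omega

variable {G}

/-- Coordinates pull back to a holomorphic map. -/
theorem HolomorphicChart.differentiableOn (φ : HolomorphicChart G) :
    DifferentiableOn ℂ (fun x => φ.toFun (proj G x)) (proj G ⁻¹' φ.source) := by
  rw [differentiableOn_pi]
  intro i
  have h := (φ.holomorphic_iff φ.target φ.open_target subset_rfl fun y => y i).1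
    (by fun_prop)
  refine DifferentiableOn.mono h fun x hx => ⟨hx, φ.map_source hx⟩

theorem HolomorphicChart.isOpen_preimage_source (φ : HolomorphicChart G) :
    IsOpen (proj G ⁻¹' φ.source) := φ.open_source.preimage (continuous_proj G)

end Action

section FiniteDimensional

variable {V : Type*} [NormedAddCommGroup V] [NormedSpace ℂ V] [FiniteDimensional ℂ V]
  (G : Subgroup (LinearMap.GeneralLinearGroup ℂ V))

/-- The continuous linear map by which an element of `G` acts. -/
def action (g : G) : V →L[ℂ] V := LinearMap.toContinuousLinearMap (actionEquiv G g : V →ₗ[ℂ] V)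

@[simp]
theorem action_apply (g : G) (v : V) : action G g v = g • v := rfl

instance continuousConstSMul : ContinuousConstSMul G V :=
  ⟨fun g => (action G g).continuous⟩

theorem isOpenMap_proj : IsOpenMap (proj G) := isOpenMap_quotient_mk'_mul

/-- As `G` acts faithfully, only the trivial subgroup fixes all of `V`: the principal stratum
consists of the free orbits. -/
theorem proj_mem_strataUpTo_zero_iff {v : V} :
    proj G v ∈ strataUpTo G 0 ↔ ∀ g : G, g • v = v → g = 1 := by
  rw [proj_mem_strataUpTo_iff]
  constructor
  · intro h g hg
    have htop : fixedSubspace G (MulAction.stabilizer G v) = ⊤ := by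
      refine Submodule.eq_top_of_finrank_eq (le_antisymm (Submodule.finrank_le _) ?_)
      rw [stratumCodim] at h
      omega
    refine eq_one_of_forall_smul fun x => ?_
    have hx : x ∈ fixedSubspace G (MulAction.stabilizer G v) := htop ▸ Submodule.mem_top
    exact hx g hg
  · intro h
    have htop : fixedSubspace G (MulAction.stabilizer G v) = ⊤ := by
      refine eq_top_iff.2 fun x _ g hg => ?_
      rw [h g hg, one_smul]
    rw [stratumCodim, htop, finrank_top, Nat.sub_self]

theorem regular_eq_iInter : {v : V | proj G v ∈ strataUpTo G 0} =
    ⋂ g : {g : G // g ≠ 1}, {v : V | (g : G) • v = v}ᶜ := by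
  ext v
  simp only [mem_iInter, mem_compl_iff, mem_ofPred_eq, proj_mem_strataUpTo_zero_iff]
  exact ⟨fun h g hg => g.2 (h g hg), fun h g hg => by_contra fun h1 => h ⟨g, h1⟩ hg⟩

variable [Finite G]

/-- The set of points with trivial isotropy group is dense. -/
theorem dense_regular : Dense {v : V | proj G v ∈ strataUpTo G 0} := by
  rw [regular_eq_iInter]
  have : CompleteSpace V := FiniteDimensional.complete ℂ V
  refine dense_iInter_of_isOpen (fun g => ?_) fun g => ?_
  · exact (isClosed_eq (continuous_const_smul (g : G)) continuous_id).isOpen_compl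
  · have h : {v : V | (g : G) • v = v} =
        (LinearMap.ker ((actionEquiv G g : V →ₗ[ℂ] V) - LinearMap.id) : Set V) := by
      ext v
      simp [sub_eq_zero]
    rw [h]
    refine dense_compl_submodule fun htop => g.2 (eq_one_of_forall_smul fun v => ?_)
    have hv : v ∈ LinearMap.ker ((actionEquiv G g : V →ₗ[ℂ] V) - LinearMap.id) :=
      htop ▸ Submodule.mem_top
    simpa [sub_eq_zero] using hv

theorem isOpen_regular : IsOpen {v : V | proj G v ∈ strataUpTo G 0} := by
  rw [regular_eq_iInter]
  exact isOpen_iInter_of_finite fun g =>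
    (isClosed_eq (continuous_const_smul (g : G)) continuous_id).isOpen_compl

/-- A point has a neighborhood that is disjoint from its translates by the elements outside of the
isotropy group of the point. -/
theorem exists_slice (v : V) :
    ∃ B : Set V, IsOpen B ∧ v ∈ B ∧ ∀ x ∈ B, ∀ g : G, g • x ∈ B → g • v = v := by
  have h : ∀ g : G, ∃ B : Set V, IsOpen B ∧ v ∈ B ∧ ∀ x ∈ B, g • x ∈ B → g • v = v := by
    intro g
    by_cases hg : g • v = v
    · exact ⟨univ, isOpen_univ, mem_univ v, fun _ _ _ => hg⟩
    · obtain ⟨A, B, hA, hB, hvA, hvB, hAB⟩ := t2_separation hg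
      refine ⟨B ∩ (fun x => g • x) ⁻¹' A, hB.inter (hA.preimage (continuous_const_smul g)),
        ⟨hvB, hvA⟩, fun x hx hgx => ?_⟩
      exact (disjoint_left.1 hAB hx.2 hgx.1).elim
  choose B hB hvB hBg using h
  exact ⟨⋂ g, B g, isOpen_iInter_of_finite hB, mem_iInter.2 hvB,
    fun x hx g hgx => hBg g x (mem_iInter.1 hx g) (mem_iInter.1 hgx g)⟩

/-! ### Holomorphic charts of the orbit space -/

variable {G}

/-- A function on `V` that is invariant under the isotropy group of `v` is, near `v`, a holomorphic
function of the coordinates. -/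
theorem HolomorphicChart.exists_descend (φ : HolomorphicChart G) {v : V}
    (hv : proj G v ∈ φ.source) {a : V → ℂ} (ha : Differentiable ℂ a)
    (hinv : ∀ g : G, g • v = v → ∀ x, a (g • x) = a x) :
    ∃ (O : Set (Coord V)) (k : Coord V → ℂ), IsOpen O ∧ φ.toFun (proj G v) ∈ O ∧
      DifferentiableOn ℂ k O ∧ ∀ᶠ x in 𝓝 v, k (φ.toFun (proj G x)) = a x := by
  classical
  obtain ⟨B, hB, hvB, hBg⟩ := exists_slice G v
  set q : OrbitSpace G → ℂ := fun z => if h : ∃ x ∈ B, proj G x = z then a h.choose else 0 with hq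
  have hqB : ∀ x ∈ B, q (proj G x) = a x := by
    intro x hx
    have h : ∃ y ∈ B, proj G y = proj G x := ⟨x, hx, rfl⟩
    simp only [hq, dif_pos h]
    obtain ⟨g, hg⟩ := (proj_eq_iff G).1 h.choose_spec.2
    have hgB : g • x ∈ B := hg ▸ h.choose_spec.1
    rw [← hg, hinv g (hBg x hx g hgB) x]
  set O : Set (Coord V) := φ.target ∩ φ.symm ⁻¹' (proj G '' B) with hO
  have hOo : IsOpen O := φ.isOpen_inter_preimage_symm (isOpenMap_proj G B hB)
  refine ⟨O, fun y => q (φ.symm y), hOo, ⟨φ.map_source hv, ?_⟩, ?_, ?_⟩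
  · exact ⟨v, hvB, (φ.left_inv hv).symm⟩
  · rw [φ.holomorphic_iff O hOo inter_subset_left]
    rintro x ⟨hx, -, y, hyB, hyx⟩
    have hyx' : proj G y = proj G x := hyx.trans (φ.left_inv hx)
    obtain ⟨g, rfl⟩ := (proj_eq_iff G).1 hyx'
    refine DifferentiableAt.differentiableWithinAt ?_
    have hda : DifferentiableAt ℂ (fun t => a (g • t)) x :=
      (ha _).comp x (action G g).differentiableAt
    refine hda.congr_of_eventuallyEq ?_
    filter_upwards [φ.isOpen_preimage_source.mem_nhds hx,
      (hB.preimage (continuous_const_smul g)).mem_nhds hyB] with t ht htB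
    have h1 : φ.symm (φ.toFun (proj G t)) = proj G t := φ.left_inv ht
    rw [h1, ← hqB _ htB, proj_smul]
  · filter_upwards [φ.isOpen_preimage_source.mem_nhds hv, hB.mem_nhds hvB] with x hx hxB
    have h1 : φ.symm (φ.toFun (proj G x)) = proj G x := φ.left_inv hx
    rw [h1, hqB x hxB]

/-- A linear form invariant under the isotropy group of `v` kills the kernel of the derivative at
`v` of the coordinates. -/
theorem HolomorphicChart.apply_eq_zero_of_fderiv_eq_zero (φ : HolomorphicChart G) {v : V}
    (hv : proj G v ∈ φ.source) (m : V →L[ℂ] ℂ)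
    (hinv : ∀ g : G, g • v = v → ∀ x, m (g • x) = m x) {X : V}
    (hX : fderiv ℂ (fun x => φ.toFun (proj G x)) v X = 0) : m X = 0 := by
  obtain ⟨O, k, hO, hvO, hk, hkm⟩ := φ.exists_descend hv m.differentiable hinv
  have h1 : DifferentiableAt ℂ (fun x => φ.toFun (proj G x)) v :=
    φ.differentiableOn.differentiableAt (φ.isOpen_preimage_source.mem_nhds hv)
  have h2 : DifferentiableAt ℂ k (φ.toFun (proj G v)) := hk.differentiableAt (hO.mem_nhds hvO)
  have h3 : fderiv ℂ (fun x => k (φ.toFun (proj G x))) v = m := by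
    rw [Filter.EventuallyEq.fderiv_eq hkm]
    exact m.hasFDerivAt.fderiv
  have h4 := fderiv_comp v h2 h1
  rw [Function.comp_def, h3] at h4
  rw [h4, ContinuousLinearMap.comp_apply, hX, map_zero]

/-- At points with trivial isotropy group the projection is immersive. -/
theorem HolomorphicChart.fderiv_injective (φ : HolomorphicChart G) {v : V}
    (hv : proj G v ∈ φ.source) (hreg : proj G v ∈ strataUpTo G 0) :
    Function.Injective (fderiv ℂ (fun x => φ.toFun (proj G x)) v) := by
  rw [injective_iff_map_eq_zero]
  intro X hX
  by_contra hX0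
  obtain ⟨m, hm⟩ := SeparatingDual.exists_eq_one (R := ℂ) hX0
  have := φ.apply_eq_zero_of_fderiv_eq_zero hv m (fun g hg x => by
    rw [(proj_mem_strataUpTo_zero_iff G).1 hreg g hg, one_smul]) hX
  exact one_ne_zero (hm.symm.trans this)

/-- The orbit of a point with trivial isotropy group has local coordinates: near the point the
projection is injective, and linear coordinates of `V` descend. -/
theorem exists_chart_of_regular {v : V} (hreg : proj G v ∈ strataUpTo G 0) :
    ∃ φ : HolomorphicChart G, proj G v ∈ φ.source := by
  obtain ⟨B, hB, hvB, hBg⟩ := exists_slice G v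
  have hfree := (proj_mem_strataUpTo_zero_iff G).1 hreg
  have hinj : InjOn (proj G) B := by
    intro x hx y hy hxy
    obtain ⟨g, rfl⟩ := (proj_eq_iff G).1 hxy
    rw [hfree g (hBg y hy g hx), one_smul]
  have : Nonempty V := ⟨v⟩
  let e : OpenPartialHomeomorph V (OrbitSpace G) :=
    OpenPartialHomeomorph.ofContinuousOpen (hinj.toPartialEquiv (proj G) B)
      (continuous_proj G).continuousOn (isOpenMap_proj G) hB
  have he : ∀ x, e x = proj G x := fun x => rfl
  have hes : e.source = B := rfl
  have het : e.target = proj G '' B := rfl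
  let L : V ≃L[ℂ] Coord V := ContinuousLinearEquiv.ofFinrankEq (by simp)
  let ψ : OpenPartialHomeomorph (OrbitSpace G) (Coord V) := e.symm.transHomeomorph L.toHomeomorph
  have hψs : ψ.source = proj G '' B := rfl
  have hψB : ∀ x ∈ B, ψ (proj G x) = L x := by
    intro x hx
    change L (e.symm (e x)) = L x
    rw [e.left_inv hx]
  have hψt : ∀ y ∈ ψ.target, ∃ x ∈ B, L x = y := fun y hy =>
    ⟨L.symm y, hy, L.apply_symm_apply y⟩
  refine ⟨⟨ψ, fun O hO hOt h => ⟨fun hh => ?_, fun hh => ?_⟩⟩, ⟨v, hvB, rfl⟩⟩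
  · rintro x ⟨⟨y, hyB, hyx⟩, hxO⟩
    obtain ⟨g, rfl⟩ := (proj_eq_iff G).1 hyx
    refine DifferentiableAt.differentiableWithinAt ?_
    have h0 : L (g • x) ∈ O := by
      have h1 : ψ (proj G x) ∈ O := hxO
      rwa [← proj_smul G g, hψB _ hyB] at h1
    have hda : DifferentiableAt ℂ (fun t => h (L (g • t))) x :=
      (hh.differentiableAt (hO.mem_nhds h0)).comp x
        (L.differentiableAt.comp x (action G g).differentiableAt)
    refine hda.congr_of_eventuallyEq ?_
    filter_upwards [(hB.preimage (continuous_const_smul g)).mem_nhds hyB] with t htB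
    change h (ψ (proj G t)) = _
    rw [← proj_smul G g, hψB _ htB]
  · intro y hy
    obtain ⟨x, hxB, rfl⟩ := hψt y (hOt hy)
    refine DifferentiableAt.differentiableWithinAt ?_
    have hxm : x ∈ proj G ⁻¹' (ψ.source ∩ ψ ⁻¹' O) := by
      refine ⟨⟨x, hxB, rfl⟩, ?_⟩
      change ψ (proj G x) ∈ O
      rwa [hψB x hxB]
    have hopen : IsOpen (proj G ⁻¹' (ψ.source ∩ ψ ⁻¹' O)) :=
      (ψ.isOpen_inter_preimage hO).preimage (continuous_proj G)
    have h1 : DifferentiableAt ℂ (fun t => h (ψ (proj G t))) x :=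
      DifferentiableOn.differentiableAt hh (hopen.mem_nhds hxm)
    have h2 : DifferentiableAt ℂ (fun t => h (L t)) x := by
      refine h1.congr_of_eventuallyEq ?_
      filter_upwards [hB.mem_nhds hxB] with t ht
      rw [hψB t ht]
    have h3 : h = fun t => h (L (L.symm t)) := by
      funext t
      rw [L.apply_symm_apply]
    rw [h3]
    refine DifferentiableAt.comp (L x) (f := fun t => L.symm t) (g := fun t => h (L t)) ?_
      L.symm.differentiableAt
    rwa [L.symm_apply_apply]

end FiniteDimensional

/-! ### Transformation of connections -/

section Transform

variable {E F H : Type*} [NormedAddCommGroup E] [NormedSpace ℂ E]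
  [NormedAddCommGroup F] [NormedSpace ℂ F] [NormedAddCommGroup H] [NormedSpace ℂ H]

theorem TransformsAt.congr_map {f f' : E → F} {Γ : E → Components E} {γ : F → Components F} {x : E}
    (h : TransformsAt f Γ γ x) (hf : f' =ᶠ[𝓝 x] f) : TransformsAt f' Γ γ x := by
  intro X Y
  rw [hf.fderiv_eq, hf.fderiv.fderiv_eq, hf.eq_of_nhds]
  exact h X Y

theorem TransformsAt.congr_left {f : E → F} {Γ Γ' : E → Components E} {γ : F → Components F} {x : E}
    (h : TransformsAt f Γ γ x) (hx : Γ' x = Γ x) : TransformsAt f Γ' γ x := by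
  intro X Y
  rw [hx]
  exact h X Y

/-- Transformations of connections compose. -/
theorem TransformsAt.comp {f : E → F} {g : F → H} {Γ : E → Components E} {γ : F → Components F}
    {η : H → Components H} {x : E} (hg : TransformsAt g γ η (f x)) (hf : TransformsAt f Γ γ x)
    (hfd : ∀ᶠ y in 𝓝 x, DifferentiableAt ℂ f y) (hf2 : DifferentiableAt ℂ (fderiv ℂ f) x)
    (hgd : ∀ᶠ y in 𝓝 (f x), DifferentiableAt ℂ g y)
    (hg2 : DifferentiableAt ℂ (fderiv ℂ g) (f x)) :
    TransformsAt (fun y => g (f y)) Γ η x := by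
  have h1 : fderiv ℂ (fun y => g (f y)) =ᶠ[𝓝 x]
      fun y => (fderiv ℂ g (f y)).comp (fderiv ℂ f y) := by
    filter_upwards [hfd, hfd.self_of_nhds.continuousAt.eventually hgd] with y hy hgy
    exact fderiv_comp y hgy hy
  have h2 : HasFDerivAt (fun y => (fderiv ℂ g (f y)).comp (fderiv ℂ f y)) _ x :=
    (hg2.hasFDerivAt.comp x hfd.self_of_nhds.hasFDerivAt).clm_comp hf2.hasFDerivAt
  intro X Y
  rw [h1.fderiv_eq, h2.fderiv, h1.eq_of_nhds]
  have hgX := hg (fderiv ℂ f x X) (fderiv ℂ f x Y)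
  have hfX := hf X Y
  simp only [ContinuousLinearMap.comp_apply, add_apply, ContinuousLinearMap.compL_apply,
    ContinuousLinearMap.flip_apply, Function.comp_apply]
  rw [hgX, hfX, map_sub]
  abel

/-- A connection is determined by its image under a map with injective derivative. -/
theorem TransformsAt.unique {f : E → F} {Γ Γ' : E → Components E} {γ : F → Components F} {x : E}
    (hinj : Function.Injective (fderiv ℂ f x)) (h : TransformsAt f Γ γ x)
    (h' : TransformsAt f Γ' γ x) : Γ x = Γ' x := by
  ext X Y
  apply hinj
  have := (h X Y).symm.trans (h' X Y)
  exact sub_left_injective this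

/-- The pullback of a connection by a map `f`, meaningful where the derivative of `f` is
invertible; elsewhere `ContinuousLinearMap.inverse` takes the value zero. -/
def pullback (f : E → F) (γ : F → Components F) (x : E) : Components E :=
  (ContinuousLinearMap.compL ℂ E F E (fderiv ℂ f x).inverse).comp
    ((γ (f x)).bilinearComp (fderiv ℂ f x) (fderiv ℂ f x) + fderiv ℂ (fderiv ℂ f) x)

theorem pullback_apply (f : E → F) (γ : F → Components F) (x X Y : E) :
    pullback f γ x X Y = (fderiv ℂ f x).inverse
      (γ (f x) (fderiv ℂ f x X) (fderiv ℂ f x Y) + fderiv ℂ (fderiv ℂ f) x X Y) := by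
  simp [pullback]

theorem transformsAt_pullback {f : E → F} (γ : F → Components F) {x : E} (e : E ≃L[ℂ] F)
    (he : fderiv ℂ f x = e) : TransformsAt f (pullback f γ) γ x := by
  intro X Y
  rw [pullback_apply, he]
  simp

variable [FiniteDimensional ℂ E] [FiniteDimensional ℂ F]

theorem differentiableAt_pullback {S : Set E} (hS : IsOpen S) {f : E → F}
    (hf : DifferentiableOn ℂ f S) {γ : F → Components F} {x : E} (hx : x ∈ S)
    (hγ : DifferentiableAt ℂ γ (f x)) (e : E ≃L[ℂ] F) (he : fderiv ℂ f x = e) :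
    DifferentiableAt ℂ (pullback f γ) x := by
  have : CompleteSpace E := FiniteDimensional.complete ℂ E
  have hd : DifferentiableAt ℂ f x := hf.differentiableAt (hS.mem_nhds hx)
  have hf1 := differentiableOn_fderiv hS hf
  have hd1 : DifferentiableAt ℂ (fderiv ℂ f) x := hf1.differentiableAt (hS.mem_nhds hx)
  have hd2 : DifferentiableAt ℂ (fderiv ℂ (fderiv ℂ f)) x :=
    (differentiableOn_fderiv hS hf1).differentiableAt (hS.mem_nhds hx)
  have hinv : DifferentiableAt ℂ (fun y => (fderiv ℂ f y).inverse) x := by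
    refine DifferentiableAt.comp x (f := fderiv ℂ f) (g := ContinuousLinearMap.inverse) ?_ hd1
    rw [he]
    exact (contDiffAt_map_inverse (n := 1) e).differentiableAt one_ne_zero
  have hγf : DifferentiableAt ℂ (fun y => γ (f y)) x :=
    DifferentiableAt.comp (G := Components F) x hγ hd
  refine differentiableAt_of_forall_apply fun X => differentiableAt_of_forall_apply fun Y => ?_
  simp only [pullback_apply]
  have hX := hd1.clm_apply (differentiableAt_const X)
  have hY := hd1.clm_apply (differentiableAt_const Y)
  exact hinv.clm_apply (((hγf.clm_apply hX).clm_apply hY).add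
    ((hd2.clm_apply (differentiableAt_const X)).clm_apply (differentiableAt_const Y)))

/-- An injective derivative between spaces of the same dimension is an isomorphism. -/
theorem exists_equiv_of_injective {A : E →L[ℂ] F} (hA : Function.Injective A)
    (h : Module.finrank ℂ E = Module.finrank ℂ F) : ∃ e : E ≃L[ℂ] F, A = e := by
  have hs : Function.Surjective A :=
    (LinearMap.injective_iff_surjective_of_finrank_eq_finrank (f := (A : E →ₗ[ℂ] F)) h).1 hA
  refine ⟨(LinearEquiv.ofBijective (A : E →ₗ[ℂ] F) ⟨hA, hs⟩).toContinuousLinearEquiv, ?_⟩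
  ext x
  rfl

end Transform

/-! ### The lift over the regular points -/

section RegularLift

variable {V : Type*} [NormedAddCommGroup V] [NormedSpace ℂ V]
  {G : Subgroup (LinearMap.GeneralLinearGroup ℂ V)}

theorem HolomorphicChart.eventually_differentiableAt (φ : HolomorphicChart G) {v : V}
    (hv : proj G v ∈ φ.source) :
    ∀ᶠ y in 𝓝 v, DifferentiableAt ℂ (fun x => φ.toFun (proj G x)) y := by
  filter_upwards [φ.isOpen_preimage_source.mem_nhds hv] with y hy
  exact φ.differentiableOn.differentiableAt (φ.isOpen_preimage_source.mem_nhds hy)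

/-- Coordinate changes of the orbit space are holomorphic. -/
theorem HolomorphicChart.differentiableOn_transition (φ ψ : HolomorphicChart G) :
    DifferentiableOn ℂ (fun y => ψ.toFun (φ.symm y)) (φ.target ∩ φ.symm ⁻¹' ψ.source) := by
  rw [differentiableOn_pi]
  intro i
  rw [φ.holomorphic_iff _ (φ.isOpen_inter_preimage_symm ψ.open_source) inter_subset_left]
  have h1 : DifferentiableOn ℂ (fun x => ψ.toFun (proj G x) i) (proj G ⁻¹' ψ.source) :=
    (differentiableOn_pi.1 ψ.differentiableOn) i
  have h2 : ∀ z ∈ φ.source, φ.symm (φ.toFun z) = z := fun z hz => φ.left_inv hz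
  have h3 : proj G ⁻¹' (φ.source ∩ φ.toFun ⁻¹' (φ.target ∩ φ.symm ⁻¹' ψ.source)) ⊆
      proj G ⁻¹' ψ.source := by
    rintro x ⟨hx, -, hx'⟩
    have : φ.symm (φ.toFun (proj G x)) ∈ ψ.source := hx'
    rwa [h2 _ hx] at this
  refine (h1.mono h3).congr fun x hx => ?_
  simp only [h2 _ hx.1]

variable [FiniteDimensional ℂ V]

theorem HolomorphicChart.differentiableAt_fderiv (φ : HolomorphicChart G) {v : V}
    (hv : proj G v ∈ φ.source) :
    DifferentiableAt ℂ (fderiv ℂ fun x => φ.toFun (proj G x)) v :=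
  (differentiableOn_fderiv φ.isOpen_preimage_source φ.differentiableOn).differentiableAt
    (φ.isOpen_preimage_source.mem_nhds hv)

theorem fderiv_smul_eq (g : G) : fderiv ℂ (fun x : V => g • x) = fun _ => action G g := by
  funext x
  exact (action G g).hasFDerivAt.fderiv

theorem transformsAt_smul_iff {Γ Γ' : V → Components V} (g : G) (v : V) :
    TransformsAt (fun x : V => g • x) Γ Γ' v ↔
      ∀ X Y : V, Γ' (g • v) (g • X) (g • Y) = g • Γ v X Y := by
  simp [TransformsAt, fderiv_smul_eq]

variable {U : Set V}

variable {γ : HolomorphicConnection G (strataUpTo G 0 ∩ proj G '' U)}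

/-- To lift `γ` at a regular point it suffices to do so in one system of coordinates. -/
theorem transformsAt_of_chart {Γ : V → Components V} {φ ψ : HolomorphicChart G} {v : V}
    (hvU : v ∈ U) (hφ : proj G v ∈ φ.source) (hψ : proj G v ∈ ψ.source)
    (hreg : proj G v ∈ strataUpTo G 0)
    (h : TransformsAt (fun x => φ.toFun (proj G x)) Γ (γ.comp φ) v) :
    TransformsAt (fun x => ψ.toFun (proj G x)) Γ (γ.comp ψ) v := by
  have ho : IsOpen (φ.target ∩ φ.symm ⁻¹' ψ.source) := φ.isOpen_inter_preimage_symm ψ.open_source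
  have hm : φ.toFun (proj G v) ∈ φ.target ∩ φ.symm ⁻¹' ψ.source := by
    refine ⟨φ.map_source hφ, ?_⟩
    have : φ.symm (φ.toFun (proj G v)) = proj G v := φ.left_inv hφ
    rwa [mem_preimage, this]
  have htr := φ.differentiableOn_transition ψ
  have h1 := TransformsAt.comp (f := fun x => φ.toFun (proj G x))
    (γ.transforms φ ψ (proj G v) ⟨⟨hφ, hψ⟩, hreg, v, hvU, rfl⟩) h
    (φ.eventually_differentiableAt hφ) (φ.differentiableAt_fderiv hφ)
    (by filter_upwards [ho.mem_nhds hm] with y hy using htr.differentiableAt (ho.mem_nhds hy))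
    ((differentiableOn_fderiv ho htr).differentiableAt (ho.mem_nhds hm))
  refine h1.congr_map ?_
  filter_upwards [φ.isOpen_preimage_source.mem_nhds hφ] with x hx
  have : φ.symm (φ.toFun (proj G x)) = proj G x := φ.left_inv hx
  rw [this]

variable [Finite G]

theorem isOpen_strataUpTo_zero : IsOpen (strataUpTo G 0) := by
  have : strataUpTo G 0 = proj G '' {v | proj G v ∈ strataUpTo G 0} :=
    (image_preimage_eq _ (proj_surjective G)).symm
  rw [this]
  exact isOpenMap_proj G _ (isOpen_regular G)

theorem HolomorphicChart.exists_equiv (φ : HolomorphicChart G) {v : V}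
    (hv : proj G v ∈ φ.source) (hreg : proj G v ∈ strataUpTo G 0) :
    ∃ e : V ≃L[ℂ] Coord V, fderiv ℂ (fun x => φ.toFun (proj G x)) v = e :=
  exists_equiv_of_injective (φ.fderiv_injective hv hreg) (by simp)

theorem eq_of_pushforwardEq {Γ Γ' : V → Components V} (h : PushforwardEq G U Γ γ)
    (h' : PushforwardEq G U Γ' γ) {v : V} (hv : v ∈ U) (hreg : proj G v ∈ strataUpTo G 0) :
    Γ v = Γ' v := by
  obtain ⟨φ, hφ⟩ := exists_chart_of_regular hreg
  exact (h φ v hv ⟨hφ, hreg⟩).unique (φ.fderiv_injective hφ hreg) (h' φ v hv ⟨hφ, hreg⟩)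

/-- The lift over the regular points: the pullback of `γ` in any coordinates around the orbit of the
point, which does not depend on them by `transformsAt_of_chart`. -/
theorem exists_regular_lift (hU : IsOpen U)
    (γ : HolomorphicConnection G (strataUpTo G 0 ∩ proj G '' U)) :
    ∃ Γ : V → Components V, DifferentiableOn ℂ Γ {v | v ∈ U ∧ proj G v ∈ strataUpTo G 0} ∧
      PushforwardEq G U Γ γ := by
  classical
  let Γ : V → Components V := fun v =>
    if h : ∃ φ : HolomorphicChart G, proj G v ∈ φ.source then
      pullback (fun x => h.choose.toFun (proj G x)) (γ.comp h.choose) v else 0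
  have hΓ : PushforwardEq G U Γ γ := by
    intro ψ v hvU hv
    have h : ∃ φ : HolomorphicChart G, proj G v ∈ φ.source := ⟨ψ, hv.1⟩
    obtain ⟨e, he⟩ := h.choose.exists_equiv h.choose_spec hv.2
    refine transformsAt_of_chart hvU h.choose_spec hv.1 hv.2
      ((transformsAt_pullback (γ.comp h.choose) e he).congr_left ?_)
    simp only [Γ, dif_pos h]
  refine ⟨Γ, fun v hv => DifferentiableAt.differentiableWithinAt ?_, hΓ⟩
  obtain ⟨φ, hφ⟩ := exists_chart_of_regular hv.2
  obtain ⟨e, he⟩ := φ.exists_equiv hφ hv.2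
  have hW : IsOpen (strataUpTo G 0 ∩ proj G '' U) :=
    isOpen_strataUpTo_zero.inter (isOpenMap_proj G U hU)
  have hm : φ.toFun (proj G v) ∈ φ.target ∩ φ.symm ⁻¹' (strataUpTo G 0 ∩ proj G '' U) := by
    refine ⟨φ.map_source hφ, ?_⟩
    have : φ.symm (φ.toFun (proj G v)) = proj G v := φ.left_inv hφ
    rw [mem_preimage, this]
    exact ⟨hv.2, v, hv.1, rfl⟩
  have hγ : DifferentiableAt ℂ (γ.comp φ) (φ.toFun (proj G v)) :=
    (γ.holomorphic φ).differentiableAt ((φ.isOpen_inter_preimage_symm hW).mem_nhds hm)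
  refine (differentiableAt_pullback φ.isOpen_preimage_source φ.differentiableOn hφ hγ e
    he).congr_of_eventuallyEq ?_
  filter_upwards [hU.mem_nhds hv.1, (isOpen_regular G).mem_nhds hv.2,
    φ.isOpen_preimage_source.mem_nhds hφ] with x hxU hxreg hxφ
  obtain ⟨e', he'⟩ := φ.exists_equiv hxφ hxreg
  exact (hΓ φ x hxU ⟨hxφ, hxreg⟩).unique (φ.fderiv_injective hxφ hxreg)
    (transformsAt_pullback (γ.comp φ) e' he')

/-- A holomorphic connection that projects to `γ` is `G`-invariant: at regular points it agrees
with its translates, which project to `γ` as well, and the regular points are dense. -/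
theorem isInvariantOn_of_pushforwardEq (hU : IsOpen U) (hGU : ∀ g : G, ∀ v ∈ U, g • v ∈ U)
    {Γ : V → Components V} (hΓ : DifferentiableOn ℂ Γ U) (h : PushforwardEq G U Γ γ) :
    IsInvariantOn G U Γ := by
  intro g v hv
  rw [transformsAt_smul_iff]
  intro X Y
  have hcont : ∀ w ∈ U, ContinuousAt Γ w := fun w hw =>
    hΓ.continuousOn.continuousAt (hU.mem_nhds hw)
  have hg : Continuous fun x : V => g • x := (action G g).continuous
  have hc1 : ContinuousAt (fun x => Γ (g • x)) v :=
    ContinuousAt.comp (f := fun x => g • x) (hcont _ (hGU g v hv)) hg.continuousAt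
  refine eq_of_eqOn_dense (f := fun x => Γ (g • x) (g • X) (g • Y)) (g := fun x => g • Γ x X Y)
    (dense_regular G) ?_ ?_ ?_
  · exact (hc1.clm_apply continuousAt_const).clm_apply continuousAt_const
  · exact hg.continuousAt.comp
      (((hcont v hv).clm_apply continuousAt_const).clm_apply continuousAt_const)
  filter_upwards [hU.mem_nhds hv] with x hxU hreg
  obtain ⟨φ, hφ⟩ := exists_chart_of_regular hreg
  have hgφ : proj G (g • x) ∈ φ.source := by rwa [proj_smul]
  have hgreg : proj G (g • x) ∈ strataUpTo G 0 := by rwa [proj_smul]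
  let e : V ≃L[ℂ] V := (actionEquiv G g).toContinuousLinearEquiv
  have htr : TransformsAt (fun x : V => g • x) (pullback (fun x : V => g • x) Γ) Γ x :=
    transformsAt_pullback Γ e (by rw [fderiv_smul_eq]; rfl)
  have h1 := (h φ (g • x) (hGU g x hxU) ⟨hgφ, hgreg⟩).comp htr
    (Eventually.of_forall fun y => (action G g).differentiableAt)
    (by rw [fderiv_smul_eq]; fun_prop)
    (φ.eventually_differentiableAt hgφ) (φ.differentiableAt_fderiv hgφ)
  simp only [proj_smul] at h1
  have h2 := (h φ x hxU ⟨hφ, hreg⟩).unique (φ.fderiv_injective hφ hreg) h1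
  exact (transformsAt_smul_iff g x).1 (htr.congr_left h2) X Y

end RegularLift

/-! ### Isotropy groups that fix a hyperplane -/

section Reflection

variable {V : Type*} [NormedAddCommGroup V] [NormedSpace ℂ V]
  {G : Subgroup (LinearMap.GeneralLinearGroup ℂ V)}

/-- The linear algebra of an isotropy group `G_v` that fixes a hyperplane pointwise:
`x = P x + l x e`, where `P` projects onto the hyperplane `l = 0` and `G_v` acts on the line of `e` by scalars. -/
structure ReflectionData (v : V) (P : V →L[ℂ] V) (l : V →L[ℂ] ℂ) (e : V) : Prop where
  apply_e : l e = 1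
  eq_add : ∀ x, x = P x + l x • e
  proj_invariant : ∀ g : G, g • v = v → ∀ x, P (g • x) = P x
  smul_eq : ∀ g : G, g • v = v → ∀ x, l x = 0 → g • x = x
  apply_smul : ∀ g : G, g • v = v → ∀ x, l (g • x) = l x * l (g • e)
  free : ∀ g : G, g • v = v → ∀ x, l x ≠ 0 → g • x = x → g = 1

variable {v : V} {P : V →L[ℂ] V} {l : V →L[ℂ] ℂ} {e : V}

/-- The character by which `G_v` acts on the line of `e`. -/
def ReflectionData.character (h : ReflectionData (G := G) v P l e) :
    MulAction.stabilizer G v →* ℂ where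
  toFun g := l ((g : G) • e)
  map_one' := by simp [h.apply_e]
  map_mul' a b := by
    have := h.apply_smul a a.2 ((b : G) • e)
    rw [Subgroup.coe_mul, mul_smul, this, mul_comm]

theorem ReflectionData.character_injective (h : ReflectionData (G := G) v P l e) :
    Function.Injective h.character := by
  rw [injective_iff_map_eq_one]
  intro g hg
  have hg' : l ((g : G) • e) = 1 := hg
  have hP : ∀ x, P x + l x • e = x := fun x => (h.eq_add x).symm
  have he : P e = 0 := by
    have := hP e
    rwa [h.apply_e, one_smul, add_eq_right] at this
  refine Subtype.ext (h.free g g.2 e (by rw [h.apply_e]; exact one_ne_zero) ?_)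
  rw [← hP ((g : G) • e), h.proj_invariant g g.2, he, hg', one_smul, zero_add]

theorem ReflectionData.apply_smul_pow (h : ReflectionData (G := G) v P l e) {g : G}
    (hg : g • v = v) (x : V) :
    l (g • x) ^ Nat.card (MulAction.stabilizer G v) =
      l x ^ Nat.card (MulAction.stabilizer G v) := by
  have h1 : h.character ⟨g, hg⟩ ^ Nat.card (MulAction.stabilizer G v) = 1 := by
    rw [← map_pow, pow_card_eq_one', map_one]
  have h2 : h.character ⟨g, hg⟩ = l (g • e) := rfl
  rw [h.apply_smul g hg, mul_pow, ← h2, h1, mul_one]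

section

variable [Finite G]

/-- The isotropy group is cyclic: it has a generator, which acts on the line of `e` by a primitive
root of unity of order `|G_v|`. -/
theorem ReflectionData.exists_generator (h : ReflectionData (G := G) v P l e) :
    ∃ (g : G) (ζ : ℂ), g • v = v ∧ IsPrimitiveRoot ζ (Nat.card (MulAction.stabilizer G v)) ∧
      ∀ x, l (g • x) = ζ * l x := by
  have : IsCyclic (MulAction.stabilizer G v) :=
    isCyclic_of_injective_ringHom h.character h.character_injective
  obtain ⟨g, hg⟩ := IsCyclic.exists_ofOrder_eq_natCard (α := MulAction.stabilizer G v)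
  refine ⟨g, h.character g, g.2, ?_, fun x => ?_⟩
  · rw [← hg, ← orderOf_injective h.character h.character_injective]
    exact IsPrimitiveRoot.orderOf _
  · rw [h.apply_smul g g.2, mul_comm]
    rfl

end

variable [FiniteDimensional ℂ V]

theorem ReflectionData.apply_eq_zero (h : ReflectionData (G := G) v P l e)
    (h0 : proj G v ∉ strataUpTo G 0) : l v = 0 := by
  by_contra hl
  exact h0 ((proj_mem_strataUpTo_zero_iff G).2 fun g hg => h.free g hg v hl hg)

variable [Finite G]

/-- The projection `P` is the average over the isotropy group; its kernel is the line of `e`. -/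
theorem exists_reflectionData {v : V} (h1 : proj G v ∈ strataUpTo G 1)
    (h0 : proj G v ∉ strataUpTo G 0) :
    ∃ P l e, ReflectionData (G := G) v P l e := by
  classical
  set K := MulAction.stabilizer G v with hK
  have := Fintype.ofFinite K
  set r : ℂ := (Fintype.card K : ℂ) with hr
  have hr0 : r ≠ 0 := Nat.cast_ne_zero.2 Fintype.card_ne_zero
  set P : V →ₗ[ℂ] V := r⁻¹ • ∑ k : K, (actionEquiv G (k : G) : V →ₗ[ℂ] V) with hP
  have hPapp : ∀ x, P x = r⁻¹ • ∑ k : K, (k : G) • x := by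
    intro x
    simp [hP]
  have hfix : ∀ x, P x ∈ fixedSubspace G K := by
    intro x g hg
    have hlin : g • P x = actionEquiv G g (P x) := rfl
    rw [hlin, hPapp, map_smul, map_sum]
    congr 1
    refine Fintype.sum_equiv (Equiv.mulLeft ⟨g, hg⟩) _ _ fun k => ?_
    simp [mul_smul, Subgroup.smul_def]
  have hPfix : ∀ x ∈ fixedSubspace G K, P x = x := by
    intro x hx
    rw [hPapp, Finset.sum_congr rfl fun (k : K) _ => hx k k.2, Finset.sum_const, Finset.card_univ,
      ← Nat.cast_smul_eq_nsmul ℂ, smul_smul, inv_mul_cancel₀ hr0, one_smul]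
  have hPinv : ∀ g ∈ K, ∀ x, P (g • x) = P x := by
    intro g hg x
    rw [hPapp, hPapp]
    congr 1
    refine Fintype.sum_equiv (Equiv.mulRight ⟨g, hg⟩) _ _ fun k => ?_
    simp [mul_smul]
  have hrange : LinearMap.range P = fixedSubspace G K := by
    refine le_antisymm ?_ fun x hx => ⟨x, hPfix x hx⟩
    rintro _ ⟨x, rfl⟩
    exact hfix x
  rw [proj_mem_strataUpTo_iff, stratumCodim, ← hK] at h1 h0
  have hrank := LinearMap.finrank_range_add_finrank_ker P
  rw [hrange] at hrank
  have hker : Module.finrank ℂ (LinearMap.ker P) = 1 := by omega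
  obtain ⟨⟨e, heP⟩, he0, hspan⟩ := finrank_eq_one_iff'.1 hker
  have he0' : e ≠ 0 := fun h => he0 (Subtype.ext h)
  obtain ⟨l₀, hl₀⟩ := SeparatingDual.exists_eq_one (R := ℂ) he0'
  set P' : V →L[ℂ] V := LinearMap.toContinuousLinearMap P with hP'
  set l : V →L[ℂ] ℂ := l₀ - l₀.comp P' with hl
  have hspan' : ∀ x, P x = 0 → x = l₀ x • e := by
    intro x hx
    obtain ⟨c, hc⟩ := hspan ⟨x, hx⟩
    have hc' : c • e = x := congrArg Subtype.val hc
    rw [← hc', map_smul, hl₀, smul_eq_mul, mul_one]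
  have hPe : P e = 0 := heP
  have hle : l e = 1 := by simp [hl, hP', hPe, hl₀]
  have heq : ∀ x, x = P x + l x • e := by
    intro x
    have h := hspan' (x - P x) (by rw [map_sub, hPfix _ (hfix x), sub_self])
    have hlx : l x = l₀ (x - P x) := by simp [hl, hP']
    rw [hlx, ← h]
    abel
  have hlin : ∀ (g : G) (x y : V) (c : ℂ), g • (x + c • y) = g • x + c • (g • y) := by
    intro g x y c
    have := (actionEquiv G g).map_add x (c • y)
    rw [map_smul] at this
    exact this
  have hge : ∀ g ∈ K, g • e = l (g • e) • e := by
    intro g hg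
    have h := heq (g • e)
    rwa [hPinv g hg, hPe, zero_add] at h
  have hgx : ∀ g ∈ K, ∀ x, g • x = P x + (l x * l (g • e)) • e := by
    intro g hg x
    conv_lhs => rw [heq x, hlin, hfix x g hg, hge g hg, smul_smul]
  have hsm : ∀ g ∈ K, ∀ x, l (g • x) = l x * l (g • e) := by
    intro g hg x
    have h := heq (g • x)
    rw [hPinv g hg, hgx g hg x] at h
    have h2 := smul_left_injective ℂ he0' (add_left_cancel h)
    rw [h2, ← hgx g hg x]
  refine ⟨P', l, e, hle, heq, hPinv, fun g hg x hx => ?_, hsm, fun g hg x hx hfx => ?_⟩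
  · rw [hgx g hg x, hx, zero_mul, zero_smul, add_zero]
    conv_rhs => rw [heq x, hx, zero_smul, add_zero]
  · have h2 := hsm g hg x
    rw [hfx] at h2
    have h3 : l (g • e) = 1 := by
      have : l x * (l (g • e) - 1) = 0 := by rw [mul_sub, ← h2]; ring
      rcases mul_eq_zero.1 this with h | h
      · exact absurd h hx
      · exact sub_eq_zero.1 h
    refine eq_one_of_forall_smul fun y => ?_
    rw [hgx g hg y, h3, mul_one]
    exact (heq y).symm

theorem two_le_card_stabilizer (h0 : proj G v ∉ strataUpTo G 0) :
    2 ≤ Nat.card (MulAction.stabilizer G v) := by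
  by_contra hlt
  have hpos : 0 < Nat.card (MulAction.stabilizer G v) := Nat.card_pos
  have hs : Subsingleton (MulAction.stabilizer G v) :=
    (Nat.card_eq_one_iff_unique.1 (by omega)).1
  refine h0 ((proj_mem_strataUpTo_zero_iff G).2 fun g hg => ?_)
  exact congrArg Subtype.val
    (Subsingleton.elim (⟨g, hg⟩ : MulAction.stabilizer G v) 1)

end Reflection

/-! ### Invariant functions near a reflection hyperplane -/

section Division

variable {E : Type*} [NormedAddCommGroup E] [NormedSpace ℂ E]

/-- Local holomorphic roots of a nonvanishing holomorphic function. -/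
theorem exists_root {S : Set E} (hS : IsOpen S) {w : E → ℂ} (hw : DifferentiableOn ℂ w S) {v : E}
    (hv : v ∈ S) (hwv : w v ≠ 0) {r : ℕ} (hr : r ≠ 0) :
    ∃ (N : Set E) (u : E → ℂ), IsOpen N ∧ v ∈ N ∧ N ⊆ S ∧ DifferentiableOn ℂ u N ∧
      ∀ x ∈ N, u x ^ r = w x := by
  have hq : DifferentiableOn ℂ (fun x => w x / w v) S := by
    simp only [div_eq_mul_inv]
    exact hw.mul_const _
  refine ⟨S ∩ (fun x => w x / w v) ⁻¹' Complex.slitPlane,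
    fun x => w v ^ ((r : ℂ)⁻¹) * (w x / w v) ^ ((r : ℂ)⁻¹),
    hq.continuousOn.isOpen_inter_preimage hS Complex.isOpen_slitPlane,
    ⟨hv, by simp [hwv]⟩, inter_subset_left, ?_, fun x hx => ?_⟩
  · exact ((hq.mono inter_subset_left).cpow (differentiableOn_const _) fun x hx => hx.2).const_mul _
  · rw [mul_pow, Complex.cpow_nat_inv_pow _ hr, Complex.cpow_nat_inv_pow _ hr]
    field_simp

variable [FiniteDimensional ℂ E]

/-- A holomorphic function that vanishes on the hyperplane of a reflection of order `r` and is
invariant under it is divisible by the `r`-th power of the equation of the hyperplane. -/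
theorem exists_eq_pow_mul {S : Set E} (hS : IsOpen S) {a : E → ℂ} (ha : DifferentiableOn ℂ a S)
    (l : E →L[ℂ] ℂ) {e : E} (he : l e = 1) (h0 : ∀ x ∈ S, l x = 0 → a x = 0) {v : E} (hv : v ∈ S)
    (hlv : l v = 0) {A : E →L[ℂ] E} {ζ : ℂ} {r : ℕ} (hζ : IsPrimitiveRoot ζ r)
    (hA : ∀ x, l (A x) = ζ * l x) (hA0 : ∀ x, l x = 0 → A x = x)
    (hinv : ∀ x ∈ S, a (A x) = a x) {s : ℕ} (hs : 1 ≤ s) (hsr : s ≤ r) :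
    ∃ (N : Set E) (b : E → ℂ), IsOpen N ∧ v ∈ N ∧ N ⊆ S ∧ DifferentiableOn ℂ b N ∧
      ∀ x ∈ N, a x = l x ^ s * b x := by
  induction s, hs using Nat.le_induction with
  | base =>
    simpa using exists_eq_mul_of_eq_zero hS ha l he h0 hv hlv
  | succ s hs ih =>
    obtain ⟨N, b, hN, hvN, hNS, hb, hab⟩ := ih (by omega)
    set M : Set E := N ∩ A ⁻¹' N with hM
    have hMo : IsOpen M := hN.inter (hN.preimage A.continuous)
    have hvM : v ∈ M := ⟨hvN, by rw [mem_preimage, hA0 v hlv]; exact hvN⟩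
    have hb0 : ∀ x ∈ M, l x = 0 → b x = 0 := by
      intro x hx hlx
      have hlker : (LinearMap.ker (l : E →ₗ[ℂ] ℂ)) ≠ ⊤ := by
        intro h
        have : e ∈ LinearMap.ker (l : E →ₗ[ℂ] ℂ) := h ▸ Submodule.mem_top
        exact one_ne_zero (he.symm.trans this)
      have hbc : ∀ y ∈ N, ContinuousAt b y := fun y hy =>
        hb.continuousOn.continuousAt (hN.mem_nhds hy)
      have hbA : ContinuousAt (fun y => b (A y)) x :=
        ContinuousAt.comp (f := A) (hbc _ hx.2) A.continuous.continuousAt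
      have key : ζ ^ s * b (A x) = b x := by
        refine eq_of_eqOn_dense (f := fun y => ζ ^ s * b (A y)) (dense_compl_submodule hlker)
          (continuousAt_const.mul hbA) (hbc x hx.1) ?_
        filter_upwards [hMo.mem_nhds hx] with y hy hly
        have hly' : l y ≠ 0 := hly
        have h1 := hinv y (hNS hy.1)
        rw [hab y hy.1, hab _ hy.2, hA, mul_pow] at h1
        refine mul_left_cancel₀ (pow_ne_zero s hly') ?_
        rw [← h1]
        ring
      rw [hA0 x hlx] at key
      have hne : ζ ^ s ≠ 1 := hζ.pow_ne_one_of_pos_of_lt (by omega) (by omega)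
      have : (ζ ^ s - 1) * b x = 0 := by rw [sub_mul, key]; ring
      exact (mul_eq_zero.1 this).resolve_left (sub_ne_zero.2 hne)
    obtain ⟨N', b', hN', hvN', hN'M, hb', hbb'⟩ :=
      exists_eq_mul_of_eq_zero hMo (hb.mono inter_subset_left) l he hb0 hvM hlv
    refine ⟨N', b', hN', hvN', fun x hx => hNS (hN'M hx).1, hb', fun x hx => ?_⟩
    rw [hab x (hN'M hx).1, hbb' x hx, pow_succ]
    ring

end Division

/-! ### The branched covering in normal form -/

section Model

variable {n : ℕ}

/-- The connection components with given coefficients `A^a_{bc}`. -/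
def ofCoeff (A : Fin n → Fin n → Fin n → ℂ) : Components (Fin n → ℂ) :=
  ∑ a, ∑ b, ∑ c, A a b c • (ContinuousLinearMap.proj (R := ℂ) (φ := fun _ : Fin n => ℂ) b).smulRight
    ((ContinuousLinearMap.proj (R := ℂ) (φ := fun _ : Fin n => ℂ) c).smulRight
      (Pi.single a (1 : ℂ) : Fin n → ℂ))

theorem ofCoeff_apply (A : Fin n → Fin n → Fin n → ℂ) (X Y : Fin n → ℂ) (a : Fin n) :
    ofCoeff A X Y a = ∑ b, ∑ c, A a b c * (X b * Y c) := by
  simp only [ofCoeff, sum_apply, Finset.sum_apply, smul_apply,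
    ContinuousLinearMap.smulRight_apply, ContinuousLinearMap.proj_apply, Pi.smul_apply, smul_eq_mul]
  rw [Finset.sum_eq_single a]
  · simp
  · intro a' _ ha'
    simp [Pi.single_eq_of_ne ha'.symm]
  · simp

theorem components_apply (B : Components (Fin n → ℂ)) (X Y : Fin n → ℂ) (a : Fin n) :
    B X Y a = ∑ b, ∑ c, B (Pi.single b 1) (Pi.single c 1) a * (X b * Y c) := by
  have h : ∀ Z : Fin n → ℂ, Z = ∑ b, Z b • (Pi.single b (1 : ℂ) : Fin n → ℂ) := fun Z => by
    simpa using (pi_eq_sum_univ' Z)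
  conv_lhs => rw [h X, h Y]
  simp only [map_sum, map_smul, sum_apply, smul_apply, Finset.sum_apply, Pi.smul_apply, smul_eq_mul,
    Finset.smul_sum]
  rw [Finset.sum_comm]
  refine Finset.sum_congr rfl fun b _ => Finset.sum_congr rfl fun c _ => ?_
  ring

/-- The branched covering `(y^1, …, y^n) ↦ (y^1, …, (y^N)^r, …, y^n)`. -/
def branch (r : ℕ) (N : Fin n) (s : Fin n → ℂ) : Fin n → ℂ :=
  Function.update s N (s N ^ r)

/-- The diagonal entries of the Jacobian matrix of `branch`. -/
def branchDeriv (r : ℕ) (N : Fin n) (s : Fin n → ℂ) (a : Fin n) : ℂ :=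
  if a = N then r * s N ^ (r - 1) else 1

theorem hasFDerivAt_branch (r : ℕ) (N : Fin n) (s : Fin n → ℂ) :
    HasFDerivAt (branch r N) (ContinuousLinearMap.pi fun a =>
      branchDeriv r N s a • ContinuousLinearMap.proj (R := ℂ) (φ := fun _ : Fin n => ℂ) a) s := by
  rw [hasFDerivAt_pi]
  intro a
  have hp : ∀ a : Fin n, HasFDerivAt (fun x : Fin n → ℂ => x a)
      (ContinuousLinearMap.proj (R := ℂ) (φ := fun _ : Fin n => ℂ) a) s := fun a =>
    hasFDerivAt_apply a s
  by_cases ha : a = N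
  · subst ha
    simp only [branch, branchDeriv, Function.update_self, if_true]
    convert! (hp a).pow r using 1
    ext x
    simp
  · simp only [branch, branchDeriv, Function.update_of_ne ha, if_neg ha, one_smul]
    exact hp a

theorem fderiv_branch_apply (r : ℕ) (N : Fin n) (s X : Fin n → ℂ) (a : Fin n) :
    fderiv ℂ (branch r N) s X a = branchDeriv r N s a * X a := by
  rw [(hasFDerivAt_branch r N s).fderiv]
  simp

theorem differentiable_branch (r : ℕ) (N : Fin n) : Differentiable ℂ (branch r N) := fun s =>
  (hasFDerivAt_branch r N s).differentiableAt

theorem differentiable_fderiv_branch (r : ℕ) (N : Fin n) :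
    Differentiable ℂ (fderiv ℂ (branch r N)) :=
  differentiableOn_univ.1 (differentiableOn_fderiv isOpen_univ
    (differentiable_branch r N).differentiableOn)

/-- The truncated exponent `r - 2` is harmless: for `r ≤ 1` the factor in front vanishes. -/
theorem fderiv_fderiv_branch_apply (r : ℕ) (N : Fin n) (s X Y : Fin n → ℂ) (a : Fin n) :
    fderiv ℂ (fderiv ℂ (branch r N)) s X Y a =
      if a = N then r * ((r - 1 : ℕ) * s N ^ (r - 2)) * (X N * Y N) else 0 := by
  have h1 : HasFDerivAt (fun t => fderiv ℂ (branch r N) t Y a)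
      ((ContinuousLinearMap.proj (R := ℂ) (φ := fun _ : Fin n => ℂ) a).comp
        ((ContinuousLinearMap.apply ℂ (Fin n → ℂ) Y).comp
          (fderiv ℂ (fderiv ℂ (branch r N)) s))) s := by
    have h2 := (differentiable_fderiv_branch r N s).hasFDerivAt
    exact ((ContinuousLinearMap.proj (R := ℂ) (φ := fun _ : Fin n => ℂ) a).hasFDerivAt).comp s
      (((ContinuousLinearMap.apply ℂ (Fin n → ℂ) Y).hasFDerivAt).comp s h2)
  have h3 : fderiv ℂ (fderiv ℂ (branch r N)) s X Y a =
      fderiv ℂ (fun t => branchDeriv r N t a * Y a) s X := by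
    simp only [← fderiv_branch_apply]
    rw [h1.fderiv]
    rfl
  rw [h3]
  by_cases ha : a = N
  · subst ha
    have hp := ((hasFDerivAt_apply (𝕜 := ℂ) a s).pow (r - 1)).const_mul (r : ℂ)
    simp only [branchDeriv, if_true]
    rw [(hp.mul_const (Y a)).fderiv]
    simp only [smul_apply, ContinuousLinearMap.proj_apply, smul_eq_mul, Nat.sub_sub]
    simp
    ring
  · simp [branchDeriv, ha]

/-- The coefficients of the pullback under `branch r N` of the connection with the coefficients
`singularForm r N T`, at a point with `N`-th coordinate `t`. They have no poles if `2 ≤ r`. -/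
def regularForm (r : ℕ) (N : Fin n) (T : Fin n → Fin n → Fin n → ℂ) (t : ℂ) (a b c : Fin n) : ℂ :=
  if b = N ∧ c = N then
    if a = N then r * t ^ (r - 1) * T a b c else r ^ 2 * t ^ (r - 2) * T a b c
  else if b = N ∨ c = N then
    if a = N then T a b c else r * t ^ (r - 1) * T a b c
  else if a = N then t * T a b c / r else T a b c

theorem branchDeriv_mul_regularForm {r : ℕ} (hr : 2 ≤ r) (N : Fin n)
    (T : Fin n → Fin n → Fin n → ℂ) {s : Fin n → ℂ} (hs : s N ≠ 0) (a b c : Fin n) :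
    branchDeriv r N s a * regularForm r N T (s N) a b c =
      singularForm r N T (s N ^ r) a b c * (branchDeriv r N s b * branchDeriv r N s c) +
        if a = N ∧ b = N ∧ c = N then (r : ℂ) * ((r - 1 : ℕ) * s N ^ (r - 2)) else 0 := by
  obtain ⟨m, rfl⟩ := Nat.exists_eq_add_of_le hr
  have hm : (2 : ℂ) + m ≠ 0 := by
    have : ((2 + m : ℕ) : ℂ) ≠ 0 := Nat.cast_ne_zero.2 (by omega)
    simpa using this
  have e3 : 2 + m = m + 2 := by omega
  set t := s N with ht
  -- the second derivative enters only for `a = b = c = N`, where it cancels the simple pole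
  by_cases ha : a = N <;> by_cases hb : b = N <;> by_cases hc : c = N <;>
    simp only [branchDeriv, regularForm, singularForm, ha, hb, hc, e3, ← ht, and_true,
      and_false, or_true, or_false, if_true, if_false,
      not_true_eq_false, not_false_eq_true, ne_eq] <;>
    push_cast <;> rw [add_comm (2 : ℂ)] at hm <;> try (field_simp; try ring)

/-- The pullback of a connection with components of the singular form under the branched covering
of the same order is holomorphic: its coefficients are given by `regularForm`. -/
theorem transformsAt_branch {r : ℕ} (hr : 2 ≤ r) (N : Fin n) (T : Fin n → Fin n → Fin n → ℂ)
    {s : Fin n → ℂ} (hs : s N ≠ 0) {Γ γ : (Fin n → ℂ) → Components (Fin n → ℂ)}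
    (hΓ : Γ s = ofCoeff (regularForm r N T (s N)))
    (hγ : ∀ a b c, γ (branch r N s) (Pi.single b 1) (Pi.single c 1) a =
      singularForm r N T (s N ^ r) a b c) :
    TransformsAt (branch r N) Γ γ s := by
  intro X Y
  funext a
  rw [components_apply, Pi.sub_apply, fderiv_branch_apply, fderiv_fderiv_branch_apply, hΓ,
    ofCoeff_apply, Finset.mul_sum]
  simp only [Finset.mul_sum, ← mul_assoc (branchDeriv r N s a),
    branchDeriv_mul_regularForm hr N T hs, add_mul, Finset.sum_add_distrib, hγ,
    fderiv_branch_apply]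
  have h : ∑ b, ∑ c, (if a = N ∧ b = N ∧ c = N then (r : ℂ) * ((r - 1 : ℕ) * s N ^ (r - 2))
      else 0) * (X b * Y c) = if a = N then r * ((r - 1 : ℕ) * s N ^ (r - 2)) * (X N * Y N) else 0 := by
    by_cases ha : a = N
    · rw [Finset.sum_eq_single N, Finset.sum_eq_single N]
      · simp [ha]
      · intro c _ hc
        simp [hc]
      · simp
      · intro b _ hb
        simp [hb]
      · simp
    · simp [ha]
  rw [h, add_sub_cancel_right]
  refine Finset.sum_congr rfl fun b _ => Finset.sum_congr rfl fun c _ => ?_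
  ring

theorem differentiableAt_ofCoeff_regularForm (r : ℕ) (N : Fin n)
    {T : (a b c : Fin n) → (Fin n → ℂ) → ℂ} {s : Fin n → ℂ}
    (hT : ∀ a b c, DifferentiableAt ℂ (T a b c) s) :
    DifferentiableAt ℂ (fun s => ofCoeff (regularForm r N (fun a b c => T a b c s) (s N))) s := by
  refine differentiableAt_of_forall_apply fun X => differentiableAt_of_forall_apply fun Y =>
    differentiableAt_pi.2 fun a => ?_
  simp only [ofCoeff_apply]
  refine DifferentiableAt.fun_sum fun b _ => DifferentiableAt.fun_sum fun c _ =>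
    DifferentiableAt.mul_const ?_ _
  unfold regularForm
  split_ifs <;> simp only [div_eq_mul_inv] <;> fun_prop

end Model

/-! ### Extension across the strata of codimension one -/

section CodimOne

variable {V : Type*} [NormedAddCommGroup V] [NormedSpace ℂ V] [FiniteDimensional ℂ V]
  {G : Subgroup (LinearMap.GeneralLinearGroup ℂ V)} [Finite G]
  {v : V} {P : V →L[ℂ] V} {l : V →L[ℂ] ℂ} {e : V}

/-- Near a point of `Z_1 \ Z_0` the reflection hyperplane consists of points over `Z_1 \ Z_0`, and
the other points are regular. -/
theorem ReflectionData.eventually_mem_strata (h : ReflectionData (G := G) v P l e)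
    (h1 : proj G v ∈ strataUpTo G 1) (h0 : proj G v ∉ strataUpTo G 0) :
    ∀ᶠ x in 𝓝 v, (l x = 0 → proj G x ∈ strataUpTo G 1 \ strataUpTo G 0) ∧
      (l x ≠ 0 → proj G x ∈ strataUpTo G 0) := by
  obtain ⟨B, hB, hvB, hBg⟩ := exists_slice G v
  have hst : ∀ x ∈ B, ∀ g : G, g • x = x → g • v = v := fun x hx g hg =>
    hBg x hx g (hg.symm ▸ hx)
  filter_upwards [hB.mem_nhds hvB] with x hx
  refine ⟨fun hl => ?_, fun hl => (proj_mem_strataUpTo_zero_iff G).2 fun g hg =>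
    h.free g (hst x hx g hg) x hl hg⟩
  have heq : MulAction.stabilizer G x = MulAction.stabilizer G v := by
    ext g
    exact ⟨fun hg => hst x hx g hg, fun hg => h.smul_eq g hg x hl⟩
  rw [Set.mem_sdiff, proj_mem_strataUpTo_iff, proj_mem_strataUpTo_iff, heq,
    ← proj_mem_strataUpTo_iff, ← proj_mem_strataUpTo_iff]
  exact ⟨h1, h0⟩

/-- The distinguished adapted coordinate is `l ^ r` times a unit. It is divisible by `l ^ r` as an
invariant function vanishing on the hyperplane. Conversely `l ^ r` descends to a holomorphic
function of the coordinates which vanishes where the distinguished coordinate does, so it is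
divisible by that coordinate. -/
theorem ReflectionData.exists_coordinate_eq (h : ReflectionData (G := G) v P l e)
    (h1 : proj G v ∈ strataUpTo G 1) (h0 : proj G v ∉ strataUpTo G 0) {φ : HolomorphicChart G}
    {N : Fin (Module.finrank ℂ V)} (hφ : IsAdaptedAt φ N (proj G v)) :
    ∃ (M : Set V) (w : V → ℂ), IsOpen M ∧ v ∈ M ∧ DifferentiableOn ℂ w M ∧ w v ≠ 0 ∧
      ∀ x ∈ M, φ.toFun (proj G x) N = l x ^ Nat.card (MulAction.stabilizer G v) * w x := by
  set r := Nat.card (MulAction.stabilizer G v) with hr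
  have hr2 : 2 ≤ r := two_le_card_stabilizer h0
  have hlv : l v = 0 := h.apply_eq_zero h0
  have hvs : proj G v ∈ φ.source := hφ.mem_source
  have hstrata := h.eventually_mem_strata h1 h0
  have hadapt : ∀ᶠ x in 𝓝 v,
      (proj G x ∈ strataUpTo G 1 \ strataUpTo G 0 ↔ φ.toFun (proj G x) N = 0) :=
    (continuous_proj G).continuousAt.eventually hφ.adapted
  have hfd : DifferentiableOn ℂ (fun x => φ.toFun (proj G x) N) (proj G ⁻¹' φ.source) :=
    (differentiableOn_pi.1 φ.differentiableOn) N
  -- the coordinate is divisible by `l ^ r`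
  obtain ⟨S, hSsub, hS, hvS⟩ := eventually_nhds_iff.1
    ((hstrata.and hadapt).and (φ.isOpen_preimage_source.mem_nhds hvs))
  obtain ⟨g, ζ, hg, hζ, hlg⟩ := h.exists_generator
  obtain ⟨M, w, hM, hvM, hMS, hw, hfw⟩ := exists_eq_pow_mul hS
    (hfd.mono fun x hx => (hSsub x hx).2) l h.apply_e
    (fun x hx hlx => (hSsub x hx).1.2.1 ((hSsub x hx).1.1.1 hlx)) hvS hlv (A := action G g) hζ
    (fun x => hlg x) (fun x hx => h.smul_eq g hg x hx) (fun x _ => by simp)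
    (by omega : 1 ≤ r) le_rfl
  refine ⟨M, w, hM, hvM, hw, ?_, hfw⟩
  -- `l ^ r` is a holomorphic function of the coordinates
  obtain ⟨O, k, hO, hvO, hk, hkl⟩ := φ.exists_descend hvs (a := fun x => l x ^ r) (by fun_prop)
    (fun g hg x => h.apply_smul_pow hg x)
  obtain ⟨S', hS'sub, hS', hvS'⟩ := eventually_nhds_iff.1 ((hstrata.and hadapt).and hkl)
  set O' : Set (Coord V) := O ∩ (φ.target ∩ φ.symm ⁻¹' (proj G '' S')) with hO'
  have hO'o : IsOpen O' := hO.inter (φ.isOpen_inter_preimage_symm (isOpenMap_proj G S' hS'))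
  have hvO' : φ.toFun (proj G v) ∈ O' :=
    ⟨hvO, φ.map_source hvs, v, hvS', (φ.left_inv hvs).symm⟩
  have hk0 : ∀ y ∈ O', y N = 0 → k y = 0 := by
    rintro y ⟨-, hyt, x, hxS', hxy⟩ hyN
    have hy : φ.toFun (proj G x) = y := by
      rw [hxy]
      exact φ.right_inv hyt
    obtain ⟨⟨hx1, hx2⟩, hx3⟩ := hS'sub x hxS'
    rw [hy] at hx2 hx3
    have hlx : l x = 0 := by
      by_contra hlx
      exact (hx2.2 hyN).2 (hx1.2 hlx)
    rw [hx3, hlx, zero_pow (by omega)]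
  obtain ⟨O₂, k₂, hO₂, hvO₂, -, hk₂, hkk₂⟩ := exists_eq_mul_of_eq_zero hO'o
    (hk.mono inter_subset_left)
    (ContinuousLinearMap.proj (R := ℂ) (φ := fun _ : Fin (Module.finrank ℂ V) => ℂ) N)
    (e := Pi.single N 1) (by simp) hk0 hvO' (by simp [hφ.centered])
  -- comparison of the two factorizations off the hyperplane
  have hfc : ContinuousAt (fun x => φ.toFun (proj G x)) v :=
    (φ.differentiableOn.differentiableAt (φ.isOpen_preimage_source.mem_nhds hvs)).continuousAt
  have hlker : LinearMap.ker (l : V →ₗ[ℂ] ℂ) ≠ ⊤ := by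
    intro htop
    have : e ∈ LinearMap.ker (l : V →ₗ[ℂ] ℂ) := htop ▸ Submodule.mem_top
    exact one_ne_zero (h.apply_e.symm.trans this)
  have hone : w v * k₂ (φ.toFun (proj G v)) = 1 := by
    refine eq_of_eqOn_dense (f := fun x => w x * k₂ (φ.toFun (proj G x))) (g := fun _ => (1 : ℂ))
      (dense_compl_submodule hlker)
      ((hw.continuousOn.continuousAt (hM.mem_nhds hvM)).mul
        (ContinuousAt.comp (f := fun x => φ.toFun (proj G x))
          (hk₂.continuousOn.continuousAt (hO₂.mem_nhds hvO₂)) hfc))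
      continuousAt_const ?_
    filter_upwards [hM.mem_nhds hvM, hkl, hfc.eventually (hO₂.mem_nhds hvO₂)]
      with x hxM hkx hxO₂ hlx
    have hlx' : l x ≠ 0 := hlx
    have h2 := hkk₂ _ hxO₂
    rw [hkx, ContinuousLinearMap.proj_apply, hfw x hxM, mul_assoc] at h2
    exact mul_left_cancel₀ (pow_ne_zero r hlx') (by rw [← h2, mul_one])
  exact left_ne_zero_of_mul (hone.trans_ne one_ne_zero)

variable {U : Set V}

/-- A lift over the regular points of a connection with the prescribed singularities extends
holomorphically across the points over `Z_1 \ Z_0`. In suitable coordinates of `V` the projection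
becomes `branch r N`. -/
theorem exists_local_extension_of_codim_one
    {γ : HolomorphicConnection G (strataUpTo G 0 ∩ proj G '' U)} (hU : IsOpen U)
    {Γ : V → Components V} (hΓ : PushforwardEq G U Γ γ) (hv : v ∈ U)
    (h1 : proj G v ∈ strataUpTo G 1) (h0 : proj G v ∉ strataUpTo G 0) {φ : HolomorphicChart G}
    {N : Fin (Module.finrank ℂ V)} (hφ : IsAdaptedAt φ N (proj G v))
    (hγ : HasSingularFormAt γ (Nat.card (MulAction.stabilizer G v)) φ N (proj G v)) :
    ∃ (M : Set V) (g : V → Components V), IsOpen M ∧ v ∈ M ∧ DifferentiableOn ℂ g M ∧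
      ∀ x ∈ M, proj G x ∈ strataUpTo G 0 → g x = Γ x := by
  obtain ⟨P, l, e, h⟩ := exists_reflectionData h1 h0
  obtain ⟨M₀, w, hM₀, hvM₀, hw, hwv, hfw⟩ := h.exists_coordinate_eq h1 h0 hφ
  obtain ⟨O, T, hO, hvO, hOt, hT, hTγ⟩ := hγ
  set r := Nat.card (MulAction.stabilizer G v) with hr
  have hr2 : 2 ≤ r := two_le_card_stabilizer h0
  have hr0 : r ≠ 0 := by omega
  have hlv : l v = 0 := h.apply_eq_zero h0
  have hvs : proj G v ∈ φ.source := hφ.mem_source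
  obtain ⟨M₁, u, hM₁, hvM₁, hM₁M₀, hu, huw⟩ := exists_root hM₀ hw hvM₀ hwv hr0
  set f : V → Coord V := fun x => φ.toFun (proj G x) with hf
  -- the coordinates `ξ` of `V` in which `f` is the branched covering
  set ξ : V → Coord V := fun x => Function.update (f x) N (l x * u x) with hξ
  set S : Set V := M₁ ∩ proj G ⁻¹' φ.source with hS
  have hSo : IsOpen S := hM₁.inter φ.isOpen_preimage_source
  have hvS : v ∈ S := ⟨hvM₁, hvs⟩
  have hξd : DifferentiableOn ℂ ξ S := by
    rw [differentiableOn_pi]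
    intro i
    by_cases hi : i = N
    · subst hi
      simp only [hξ, Function.update_self]
      exact l.differentiable.differentiableOn.mul (hu.mono inter_subset_left)
    · simp only [hξ, Function.update_of_ne hi]
      exact (differentiableOn_pi.1 φ.differentiableOn i).mono inter_subset_right
  have hbranch : ∀ x ∈ S, branch r N (ξ x) = f x := by
    intro x hx
    simp only [branch, hξ, Function.update_self, Function.update_idem, mul_pow, huw x hx.1]
    rw [← hfw x (hM₁M₀ hx.1)]
    exact Function.update_eq_self N (f x)
  have huv : u v ≠ 0 := by
    intro h2
    have := huw v hvM₁
    rw [h2, zero_pow hr0] at this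
    exact hwv this.symm
  have hξdv : DifferentiableAt ℂ ξ v := hξd.differentiableAt (hSo.mem_nhds hvS)
  have hinj : Function.Injective (fderiv ℂ ξ v) := by
    rw [injective_iff_map_eq_zero]
    intro X hX
    have hlX : l X = 0 := by
      have hd1 : HasFDerivAt (fun x => l x * u x)
          ((ContinuousLinearMap.proj (R := ℂ) (φ := fun _ : Fin (Module.finrank ℂ V) => ℂ) N).comp
            (fderiv ℂ ξ v)) v := by
        have h2 := (hasFDerivAt_pi'.1 hξdv.hasFDerivAt) N
        simpa only [hξ, Function.update_self] using h2
      have hd2 := l.hasFDerivAt.mul (hu.differentiableAt (hM₁.mem_nhds hvM₁)).hasFDerivAt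
      have h3 := congrArg (fun A : V →L[ℂ] ℂ => A X) (hd1.unique hd2)
      simp only [ContinuousLinearMap.comp_apply, hX, map_zero, add_apply, smul_apply, hlv,
        smul_eq_mul, zero_mul, zero_add] at h3
      exact (mul_eq_zero.1 h3.symm).resolve_left huv
    have hfX : fderiv ℂ f v X = 0 := by
      have hev : f =ᶠ[𝓝 v] fun x => branch r N (ξ x) := by
        filter_upwards [hSo.mem_nhds hvS] with x hx using (hbranch x hx).symm
      have h2 := fderiv_comp v (differentiable_branch r N (ξ v)) hξdv
      rw [hev.fderiv_eq]
      rw [Function.comp_def] at h2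
      rw [h2, ContinuousLinearMap.comp_apply, hX, map_zero]
    -- `m ∘ P` is an invariant linear form for each linear form `m`, so it vanishes at `X = P X`
    have hPX : X = P X := by
      have h2 := h.eq_add X
      rwa [hlX, zero_smul, add_zero] at h2
    by_contra hX0
    obtain ⟨m, hm⟩ := SeparatingDual.exists_eq_one (R := ℂ) hX0
    have h2 : (m.comp P) X = 0 := φ.apply_eq_zero_of_fderiv_eq_zero hvs (m.comp P)
      (fun g hg x => by simp only [ContinuousLinearMap.comp_apply, h.proj_invariant g hg]) hfX
    rw [ContinuousLinearMap.comp_apply, ← hPX, hm] at h2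
    exact one_ne_zero h2
  obtain ⟨E₀, hE₀⟩ := exists_equiv_of_injective hinj (by simp)
  have hequiv : ∀ᶠ x in 𝓝 v, ∃ E : V ≃L[ℂ] Coord V, fderiv ℂ ξ x = E := by
    have : CompleteSpace V := FiniteDimensional.complete ℂ V
    have hc : ContinuousAt (fderiv ℂ ξ) v :=
      ((differentiableOn_fderiv hSo hξd).differentiableAt (hSo.mem_nhds hvS)).continuousAt
    have h2 := ContinuousLinearEquiv.nhds E₀
    rw [← hE₀] at h2
    filter_upwards [hc.eventually h2] with x hx
    obtain ⟨E, hE⟩ := hx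
    exact ⟨E, hE.symm⟩
  have hfc : ContinuousAt f v :=
    (φ.differentiableOn.differentiableAt (φ.isOpen_preimage_source.mem_nhds hvs)).continuousAt
  have hadapt : ∀ᶠ x in 𝓝 v, (proj G x ∈ strataUpTo G 1 \ strataUpTo G 0 ↔ f x N = 0) :=
    (continuous_proj G).continuousAt.eventually hφ.adapted
  have hSv : ∀ᶠ x in 𝓝 v, x ∈ S := hSo.mem_nhds hvS
  have hUv : ∀ᶠ x in 𝓝 v, x ∈ U := hU.mem_nhds hv
  obtain ⟨M, hMsub, hM, hvM⟩ := eventually_nhds_iff.1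
    (((hSv.and hequiv).and (hfc.eventually (hO.mem_nhds hvO))).and (hadapt.and hUv))
  set Γ₁ : Coord V → Components (Coord V) := fun s =>
    ofCoeff (regularForm r N (fun a b c => T a b c (branch r N s)) (s N)) with hΓ₁
  refine ⟨M, pullback ξ Γ₁, hM, hvM, fun x hx => ?_, fun x hx hreg => ?_⟩
  · obtain ⟨⟨⟨hxS, E, hE⟩, hxO⟩, -, -⟩ := hMsub x hx
    refine (differentiableAt_pullback hSo hξd hxS ?_ E hE).differentiableWithinAt
    refine differentiableAt_ofCoeff_regularForm r N fun a b c => ?_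
    refine DifferentiableAt.comp (ξ x) (f := branch r N) ?_ (differentiable_branch r N (ξ x))
    rw [hbranch x hxS]
    exact (hT a b c).differentiableAt (hO.mem_nhds hxO)
  · obtain ⟨⟨⟨hxS, E, hE⟩, hxO⟩, hxa, hxU⟩ := hMsub x hx
    have hfN : branch r N (ξ x) N ≠ 0 := by
      rw [hbranch x hxS]
      exact fun h2 => (hxa.2 h2).2 hreg
    have hξN : ξ x N ≠ 0 := by
      intro h2
      rw [branch, Function.update_self, h2, zero_pow hr0] at hfN
      exact hfN rfl
    have htr : TransformsAt (branch r N) Γ₁ (γ.comp φ) (ξ x) := by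
      refine transformsAt_branch hr2 N (fun a b c => T a b c (f x)) hξN ?_ fun a b c => ?_
      · simp only [hΓ₁, hbranch x hxS]
      · have hmem : φ.symm (f x) ∈ strataUpTo G 0 ∩ proj G '' U := by
          have : φ.symm (f x) = proj G x := φ.left_inv hxS.2
          rw [this]
          exact ⟨hreg, x, hxU, rfl⟩
        have h3 : ξ x N ^ r = f x N := by
          rw [← hbranch x hxS, branch, Function.update_self]
        rw [hbranch x hxS, h3]
        exact hTγ (f x) hxO hmem a b c
    have hcomp := htr.comp (transformsAt_pullback Γ₁ E hE)
      (by filter_upwards [hSo.mem_nhds hxS] with y hy using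
        hξd.differentiableAt (hSo.mem_nhds hy))
      ((differentiableOn_fderiv hSo hξd).differentiableAt (hSo.mem_nhds hxS))
      (Eventually.of_forall (differentiable_branch r N)) (differentiable_fderiv_branch r N _)
    have hf' : TransformsAt f (pullback ξ Γ₁) (γ.comp φ) x := by
      refine hcomp.congr_map ?_
      filter_upwards [hSo.mem_nhds hxS] with y hy using (hbranch y hy).symm
    exact hf'.unique (φ.fderiv_injective hxS.2 hreg) (hΓ φ x hxU ⟨hxS.2, hreg⟩)

end CodimOne

/-! ### Extension across the strata of higher codimension -/

section HigherCodim

variable {V : Type*} [NormedAddCommGroup V] [NormedSpace ℂ V] [FiniteDimensional ℂ V]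
  {G : Subgroup (LinearMap.GeneralLinearGroup ℂ V)} [Finite G]

/-- The points over the strata of codimension at least two lie on finitely many subspaces of
codimension at least two, so Hartogs' theorem applies to their complement. -/
theorem exists_extension_of_strataUpTo_one {F : Type*} [NormedAddCommGroup F] [NormedSpace ℂ F]
    [FiniteDimensional ℂ F] {U : Set V} (hU : IsOpen U) {f : V → F}
    (hf : DifferentiableOn ℂ f {v | v ∈ U ∧ proj G v ∈ strataUpTo G 1}) :
    ∃ g : V → F, DifferentiableOn ℂ g U ∧ ∀ v ∈ U, proj G v ∈ strataUpTo G 1 → g v = f v := by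
  classical
  have : Fintype (Subgroup G) := Fintype.ofFinite _
  set s : Finset (Submodule ℂ V) := (Finset.univ.filter fun K : Subgroup G =>
    1 < stratumCodim G K).image (fixedSubspace G) with hs
  have hmem : ∀ v, proj G v ∈ strataUpTo G 1 ↔ ∀ W ∈ s, v ∉ W := by
    intro v
    rw [proj_mem_strataUpTo_iff]
    constructor
    · intro h W hW hvW
      obtain ⟨K, hK, rfl⟩ := Finset.mem_image.1 hW
      have hK1 := (Finset.mem_filter.1 hK).2
      have hle : fixedSubspace G (MulAction.stabilizer G v) ≤ fixedSubspace G K :=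
        fun x hx g hg => hx g (hvW g hg)
      have := Submodule.finrank_mono hle
      rw [stratumCodim] at h hK1
      omega
    · intro h
      by_contra hlt
      exact h (fixedSubspace G (MulAction.stabilizer G v))
        (Finset.mem_image.2 ⟨_, Finset.mem_filter.2 ⟨Finset.mem_univ _, not_le.1 hlt⟩, rfl⟩)
        fun g hg => hg
  simp only [hmem] at hf ⊢
  refine exists_extension_of_codim_two s hU (fun W hW => ?_) hf
  obtain ⟨K, hK, rfl⟩ := Finset.mem_image.1 hW
  have hK1 := (Finset.mem_filter.1 hK).2
  rw [stratumCodim] at hK1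
  omega

end HigherCodim

end OrbitConnection

end

theorem theorem4p2 {V : Type*} [NormedAddCommGroup V] [NormedSpace ℂ V] [FiniteDimensional ℂ V]
    (G : Subgroup (LinearMap.GeneralLinearGroup ℂ V)) [Finite G]
    (U : Set V) (hU : IsOpen U) (hGU : ∀ g : G, ∀ v ∈ U, g • v ∈ U)
    (γ : OrbitConnection.HolomorphicConnection G
      (OrbitConnection.strataUpTo G 0 ∩ OrbitConnection.proj G '' U))
    (hγ : ∀ v ∈ U,
      OrbitConnection.proj G v ∈
          OrbitConnection.strataUpTo G 1 \ OrbitConnection.strataUpTo G 0 →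
        ∃ (φ : OrbitConnection.HolomorphicChart G) (N : Fin (Module.finrank ℂ V)),
          OrbitConnection.IsAdaptedAt φ N (OrbitConnection.proj G v) ∧
          OrbitConnection.HasSingularFormAt γ (Nat.card (MulAction.stabilizer G v)) φ N
            (OrbitConnection.proj G v)) :
    ∃ Γ : V → OrbitConnection.Components V,
      OrbitConnection.IsInvariantLift G U Γ γ ∧
      ∀ Γ' : V → OrbitConnection.Components V,
        OrbitConnection.IsInvariantLift G U Γ' γ → EqOn Γ' Γ U := by
  open OrbitConnection in
  obtain ⟨Γ₀, hΓ₀, hpush₀⟩ := exists_regular_lift hU γ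
  have hregU : IsOpen {v | v ∈ U ∧ proj G v ∈ strataUpTo G 0} := hU.inter (isOpen_regular G)
  obtain ⟨Γ₁, hΓ₁, hΓ₁₀⟩ := exists_differentiableOn_of_local
    (U := {v | v ∈ U ∧ proj G v ∈ strataUpTo G 1}) (dense_regular G) (f := Γ₀) fun v hv => by
      by_cases h0 : proj G v ∈ strataUpTo G 0
      · exact ⟨_, Γ₀, hregU, ⟨hv.1, h0⟩, hΓ₀, fun _ _ _ => rfl⟩
      · obtain ⟨φ, N, hφ, hsing⟩ := hγ v hv.1 ⟨hv.2, h0⟩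
        exact exists_local_extension_of_codim_one hU hpush₀ hv.1 hv.2 h0 hφ hsing
  obtain ⟨Γ, hΓ, hΓΓ₁⟩ := exists_extension_of_strataUpTo_one hU hΓ₁
  have hpush : PushforwardEq G U Γ γ := by
    intro φ v hv hφ
    have h1 : proj G v ∈ strataUpTo G 1 :=
      (proj_mem_strataUpTo_iff G).2 (((proj_mem_strataUpTo_iff G).1 hφ.2).trans zero_le_one)
    exact (hpush₀ φ v hv hφ).congr_left
      ((hΓΓ₁ v hv h1).trans (hΓ₁₀ v ⟨hv, h1⟩ hφ.2))
  refine ⟨Γ, ⟨hΓ, isInvariantOn_of_pushforwardEq hU hGU hΓ hpush, hpush⟩, fun Γ' h' v hv => ?_⟩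
  refine eq_of_eqOn_dense (dense_regular G)
    (h'.holomorphic.continuousOn.continuousAt (hU.mem_nhds hv))
    (hΓ.continuousOn.continuousAt (hU.mem_nhds hv)) ?_
  filter_upwards [hU.mem_nhds hv] with x hx hreg
    using eq_of_pushforwardEq h'.pushforward hpush hx hreg
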